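/- Let $d\ge 1$, $0<\alpha<1$ and $0<\gamma\le d$. A nonnegative Borel measure $\mu$ on $\mathbb R^d$ is called $\gamma$-dimensional if there is a finite constant $C_\mu\ge 0$ with $\mu(B(x,r))\le C_\mu r^\gamma$ for all $x\in\mathbb R^d$ and $r>0$, where $B(x,r)=\{y\in\mathbb R^d:|x-y|<r\}$; $\langle\mu\rangle_\gamma$ denotes the infimum of such constants. For $f\in L^2(\mathbb R^d)$ let $\widehat f$ be its Fourier transform (normalized as $\widehat f(\xi)=\int_{\mathbb R^d} e^{-ix\cdot\xi}f(x)\,dx$ for integrable $f$), and when $\widehat f$ has compact support put $$e^{it(-\Delta)^{\alpha/2}}f(x)=(2\pi)^{-d}\int_{\mathbb R^d} e^{i(x\cdot\xi+t|\xi|^\alpha)}\,\widehat f(\xi)\,d\xi ,\qquad x\in\mathbb R^d,\ t\in\mathbb R.$$ Suppose $$s>\min\Big\{\max\Big\{0,\ \alpha\Big(\frac\gamma2-\frac d4\Big)\Big\},\ \frac\alpha2\Big\}.$$ Then there is a constant $C>0$, depending only on $d,\alpha,\gamma,s$, such that $$\Big\|\sup_{0<t\le1}\big|e^{it(-\Delta)^{\alpha/2}}f\big|\Big\|_{L^2(B(0,1),\,d\mu)}\le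 C\,R^{\frac{d-\gamma}2+s}\,\langle\mu\rangle_\gamma^{1/2}\,\|f\|_{L^2(\mathbb R^d)}$$ for every $\gamma$-dimensional measure $\mu$ on $\mathbb R^d$, every $R\ge1$, and every $f\in L^2(\mathbb R^d)$ such that $\widehat f$ is supported in $\{\xi\in\mathbb R^d: R\le|\xi|\le 2R\}$. -/

import Mathlib

open MeasureTheory Metric Set
open scoped FourierTransform ENNReal NNReal

/-- The space `ℝ^d` with its Euclidean norm, inner product and Borel `σ`-algebra. -/
abbrev Rd (d : ℕ) : Type := EuclideanSpace ℝ (Fin d)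

/-- `C` is an admissible constant for `μ`: `μ (B(x,r)) ≤ C * r ^ γ` for all `x` and all `r > 0`. -/
def IsBallBound {d : ℕ} (γ : ℝ) (μ : Measure (Rd d)) (C : ℝ≥0) : Prop :=
  ∀ (x : Rd d) (r : ℝ), 0 < r → μ (ball x r) ≤ ENNReal.ofReal ((C : ℝ) * r ^ γ)

/-- The Borel measure `μ` on `ℝ^d` is `γ`-dimensional. -/
def IsGammaDimensional {d : ℕ} (γ : ℝ) (μ : Measure (Rd d)) : Prop :=
  ∃ C : ℝ≥0, IsBallBound γ μ C

/-- `⟨μ⟩_γ`, the infimum of the constants `C` with `μ (B(x,r)) ≤ C * r ^ γ` for all `x`, `r > 0`. -/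
noncomputable def dimConst {d : ℕ} (γ : ℝ) (μ : Measure (Rd d)) : ℝ≥0 :=
  sInf {C : ℝ≥0 | IsBallBound γ μ C}

/-- For `f ∈ L²(ℝ^d)`: the Fourier transform of `f` is supported in `{ξ : R ≤ |ξ| ≤ 2R}`.
Here `𝓕 f` is the Plancherel transform with kernel `exp (-2πi ⟨x, η⟩)`, so that the frequency
variable `ξ` dual to `x` in `exp (i ⟨x, ξ⟩)` is `ξ = 2πη`. The annulus is closed, so containing
the support means vanishing almost everywhere outside. -/
def FourierSupportedInAnnulus {d : ℕ} (R : ℝ) (f : Lp ℂ 2 (volume : Measure (Rd d))) : Prop :=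
  ∀ᵐ η : Rd d, ¬ (R ≤ 2 * Real.pi * ‖η‖ ∧ 2 * Real.pi * ‖η‖ ≤ 2 * R) →
    (𝓕 f : Lp ℂ 2 (volume : Measure (Rd d))) η = 0

/-- `exp (i t (-Δ)^{α/2}) f (x)`, for `f ∈ L²(ℝ^d)` whose Fourier transform has compact support:
the inverse Fourier integral of `exp (i t |ξ|^α)` times the Fourier transform of `f`, with
`ξ = 2πη`. The integral converges absolutely for every `x` (a function in `L²` with compact
support is integrable), so that this is the continuous representative of the `L²` function. -/
noncomputable def fracSchrodinger {d : ℕ} (α t : ℝ) (f : Lp ℂ 2 (volume : Measure (Rd d)))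
    (x : Rd d) : ℂ :=
  𝓕⁻ (fun η : Rd d => Complex.exp (Complex.I * ((t * (2 * Real.pi * ‖η‖) ^ α : ℝ) : ℂ)) *
    (𝓕 f : Lp ℂ 2 (volume : Measure (Rd d))) η) x

/-- The maximal function `sup_{0 < t ≤ 1} |exp (i t (-Δ)^{α/2}) f (x)|`, with values in `[0, ∞]`. -/
noncomputable def maximalFunction {d : ℕ} (α : ℝ) (f : Lp ℂ 2 (volume : Measure (Rd d)))
    (x : Rd d) : ℝ≥0∞ :=
  ⨆ t ∈ Ioc (0 : ℝ) 1, ‖fracSchrodinger α t f x‖ₑ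

/-!
Linearise the supremum by a measurable choice of times `τ(x)`. For `f` localised to
`R ≤ |ξ| ≤ 2R`, `exp (i τ(x) (-Δ) ^ (α / 2)) f (x)` is the pairing of `𝓕 f` with a wave packet, and
the Gram matrix of the wave packets is the unit-frequency kernel evaluated at time
`(τ(x) - τ(y)) R ^ α` and position `R (x - y)`. By duality and Schur's test it suffices to integrate
the modulus of this kernel in `y` against `μ`.

The kernel decays like `|w| ^ (-d / 2)` uniformly in time: it is radial, its radial profile solves
Bessel's equation and is thus a sum of two waves with slowly varying amplitudes, and van der
Corput's lemma gains a further `|w| ^ (-1 / 2)` over the decay `|w| ^ (-(d - 1) / 2)` of those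
waves. Interpolation with the non-stationary bound `(1 + |t|) ^ N (1 + |w|) ^ (-N)` gives decay
`(1 + |w|) ^ (-p)`, for every `p < d / 2 + σ`, at the cost of `(1 + |t|) ^ σ`. This is integrable
against a `γ`-dimensional measure as soon as `γ < p`. Taking `σ = 2s / α` on the whole time interval
gives the first bound on `s`; cutting `(0, 1]` into about `R ^ α` intervals, on which the rescaled
time is bounded, and summing gives the second.
-/

open scoped ContDiff

section VanDerCorput

variable {φ φ' φ'' : ℝ → ℝ} {p q l : ℝ}

theorem norm_integral_cexp_le_sub (hpq : p ≤ q) :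
    ‖∫ x in p..q, Complex.exp (φ x * Complex.I)‖ ≤ q - p := by
  simpa [abs_of_nonneg (sub_nonneg.2 hpq)] using
    intervalIntegral.norm_integral_le_of_norm_le_const (a := p) (b := q)
      fun x _ => (Complex.norm_exp_ofReal_mul_I (φ x)).le

theorem continuousOn_cexp_mul_I (hφ : ∀ x ∈ Icc p q, HasDerivAt φ (φ' x) x) :
    ContinuousOn (fun x => Complex.exp (φ x * Complex.I)) (Icc p q) :=
  ((Complex.continuous_ofReal.comp_continuousOn (HasDerivAt.continuousOn hφ)).mul
    continuousOn_const).cexp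

theorem norm_integral_cexp_le_integral_div_sq (hpq : p ≤ q)
    (hφ : ∀ x ∈ Icc p q, HasDerivAt φ (φ' x) x) (hφ' : ∀ x ∈ Icc p q, HasDerivAt φ' (φ'' x) x)
    (hφ'' : ContinuousOn φ'' (Icc p q)) (hne : ∀ x ∈ Icc p q, φ' x ≠ 0) :
    ‖∫ x in p..q, Complex.exp (φ x * Complex.I)‖ ≤
      |φ' q|⁻¹ + |φ' p|⁻¹ + ∫ x in p..q, |φ'' x / φ' x ^ 2| := by
  have hφ'c : ContinuousOn φ' (Icc p q) := HasDerivAt.continuousOn hφ'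
  have hexp := continuousOn_cexp_mul_I hφ
  rw [← uIcc_of_le hpq] at hφ hφ' hφ'' hne hφ'c hexp
  set u : ℝ → ℂ := fun x => (((φ' x)⁻¹ : ℝ) : ℂ) * -Complex.I with hu
  set u' : ℝ → ℂ := fun x => ((-φ'' x / φ' x ^ 2 : ℝ) : ℂ) * -Complex.I with hu'
  set v : ℝ → ℂ := fun x => Complex.exp (φ x * Complex.I) with hv
  have hnorm_u (x : ℝ) : ‖u x * v x‖ = |φ' x|⁻¹ := by
    simp [hu, hv, Complex.norm_exp_ofReal_mul_I]
  have hnorm_u' (x : ℝ) : ‖u' x * v x‖ = |φ'' x / φ' x ^ 2| := by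
    simp [hu', hv, Complex.norm_exp_ofReal_mul_I, abs_div]
  have hparts : ∫ x in p..q, u x * (v x * (φ' x * Complex.I)) =
      u q * v q - u p * v p - ∫ x in p..q, u' x * v x := by
    refine intervalIntegral.integral_mul_deriv_eq_deriv_mul
      (fun x hx => ((hφ' x hx).fun_inv (hne x hx)).ofReal_comp.mul_const _)
      (fun x hx => ((hφ x hx).ofReal_comp.mul_const _).cexp)
      (ContinuousOn.intervalIntegrable ?_) (ContinuousOn.intervalIntegrable ?_)
    · exact (Complex.continuous_ofReal.comp_continuousOn
        (hφ''.neg.div (hφ'c.pow 2) fun x hx => pow_ne_zero _ (hne x hx))).mul continuousOn_const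
    · exact hexp.mul ((Complex.continuous_ofReal.comp_continuousOn hφ'c).mul continuousOn_const)
  have hcancel : ∫ x in p..q, v x = ∫ x in p..q, u x * (v x * (φ' x * Complex.I)) := by
    refine intervalIntegral.integral_congr fun x hx => ?_
    have : (φ' x : ℂ) ≠ 0 := by exact_mod_cast hne x hx
    simp only [hu, Complex.ofReal_inv]
    field_simp
    simp
  calc ‖∫ x in p..q, v x‖
      ≤ ‖u q * v q‖ + ‖u p * v p‖ + ‖∫ x in p..q, u' x * v x‖ := by
        rw [hcancel, hparts]
        exact (norm_sub_le _ _).trans (by gcongr; exact norm_sub_le _ _)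
    _ ≤ |φ' q|⁻¹ + |φ' p|⁻¹ + ∫ x in p..q, |φ'' x / φ' x ^ 2| := by
        rw [hnorm_u, hnorm_u]
        gcongr
        exact (intervalIntegral.norm_integral_le_integral_norm hpq).trans_eq
          (by simp only [hnorm_u'])

theorem norm_integral_cexp_le_of_le_abs_deriv (hpq : p ≤ q) (hl : 0 < l)
    (hφ : ∀ x ∈ Icc p q, HasDerivAt φ (φ' x) x) (hφ' : ∀ x ∈ Icc p q, HasDerivAt φ' (φ'' x) x)
    (hφ'' : ContinuousOn φ'' (Icc p q)) (hconvex : ∀ x ∈ Icc p q, 0 ≤ φ'' x)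
    (hge : ∀ x ∈ Icc p q, l ≤ |φ' x|) :
    ‖∫ x in p..q, Complex.exp (φ x * Complex.I)‖ ≤ 4 / l := by
  have hne (x) (hx : x ∈ Icc p q) : φ' x ≠ 0 := abs_pos.1 (hl.trans_le (hge x hx))
  have hinv (x) (hx : x ∈ Icc p q) : |φ' x|⁻¹ ≤ 1 / l := by
    rw [one_div]
    exact inv_anti₀ hl (hge x hx)
  have hφ'c : ContinuousOn φ' (Icc p q) := HasDerivAt.continuousOn hφ'
  have hvariation : ∫ x in p..q, |φ'' x / φ' x ^ 2| = (φ' p)⁻¹ - (φ' q)⁻¹ := by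
    rw [← neg_sub_neg]
    refine intervalIntegral.integral_eq_sub_of_hasDerivAt (f := fun x => -(φ' x)⁻¹)
      (fun x hx => ?_) (ContinuousOn.intervalIntegrable ?_) |>.trans (by ring)
    · rw [uIcc_of_le hpq] at hx
      rw [abs_of_nonneg (div_nonneg (hconvex x hx) (sq_nonneg _))]
      exact ((hφ' x hx).fun_inv (hne x hx)).fun_neg.congr_deriv (by ring)
    · rw [uIcc_of_le hpq]
      exact (hφ''.div (hφ'c.pow 2) fun x hx => pow_ne_zero _ (hne x hx)).abs
  have hp := hinv p (left_mem_Icc.2 hpq)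
  have hq := hinv q (right_mem_Icc.2 hpq)
  have hp' := le_abs_self (φ' p)⁻¹
  have hq' := neg_le_abs (φ' q)⁻¹
  rw [abs_inv] at hp' hq'
  calc ‖∫ x in p..q, Complex.exp (φ x * Complex.I)‖
      ≤ |φ' q|⁻¹ + |φ' p|⁻¹ + ∫ x in p..q, |φ'' x / φ' x ^ 2| :=
        norm_integral_cexp_le_integral_div_sq hpq hφ hφ' hφ'' hne
    _ ≤ 1 / l + 1 / l + (1 / l + 1 / l) := by rw [hvariation]; linarith
    _ = 4 / l := by ring

theorem norm_integral_cexp_le_of_le_deriv2_of_nonneg (hpq : p ≤ q) (hl : 0 < l)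
    (hφ : ∀ x ∈ Icc p q, HasDerivAt φ (φ' x) x) (hφ' : ∀ x ∈ Icc p q, HasDerivAt φ' (φ'' x) x)
    (hφ'' : ContinuousOn φ'' (Icc p q)) (hge : ∀ x ∈ Icc p q, l ≤ φ'' x) (hp : 0 ≤ φ' p) :
    ‖∫ x in p..q, Complex.exp (φ x * Complex.I)‖ ≤ 5 / √l := by
  have hsqrt : 0 < √l := Real.sqrt_pos.2 hl
  rcases le_or_gt q (p + 1 / √l) with hshort | hlong
  · calc _ ≤ q - p := norm_integral_cexp_le_sub hpq
      _ ≤ 1 / √l := by linarith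
      _ ≤ 5 / √l := by gcongr; norm_num
  set m := p + 1 / √l
  have hpm : p ≤ m := le_add_of_nonneg_right (by positivity)
  have hsub : Icc m q ⊆ Icc p q := Icc_subset_Icc_left hpm
  have hderiv (x) (hx : x ∈ Icc m q) : √l ≤ |φ' x| := by
    have hgrowth : l * (x - p) ≤ φ' x - φ' p :=
      (convex_Icc p q).mul_sub_le_image_sub_of_le_deriv (HasDerivAt.continuousOn hφ')
        (fun y hy => (hφ' y (interior_subset hy)).differentiableAt.differentiableWithinAt)
        (fun y hy => (hφ' y (interior_subset hy)).deriv ▸ hge y (interior_subset hy))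
        p (left_mem_Icc.2 hpq) x (hsub hx) (hsub hx).1
    calc √l = l * (1 / √l) := by rw [mul_one_div, Real.div_sqrt]
      _ ≤ l * (x - p) := by gcongr; linarith [hx.1, show m = p + 1 / √l from rfl]
      _ ≤ |φ' x| := le_trans (by linarith) (le_abs_self _)
  have hexp := continuousOn_cexp_mul_I hφ
  rw [← intervalIntegral.integral_add_adjacent_intervals
    ((hexp.mono (Icc_subset_Icc_right hlong.le)).intervalIntegrable_of_Icc hpm)
    ((hexp.mono hsub).intervalIntegrable_of_Icc hlong.le)]
  calc _ ≤ (m - p) + 4 / √l := (norm_add_le _ _).trans (add_le_add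
        (norm_integral_cexp_le_sub hpm)
        (norm_integral_cexp_le_of_le_abs_deriv hlong.le hsqrt (fun x hx => hφ x (hsub hx))
          (fun x hx => hφ' x (hsub hx)) (hφ''.mono hsub)
          (fun x hx => hl.le.trans (hge x (hsub hx))) hderiv))
    _ = 5 / √l := by simp only [m]; ring

theorem norm_integral_cexp_le_of_le_deriv2_of_nonpos (hpq : p ≤ q) (hl : 0 < l)
    (hφ : ∀ x ∈ Icc p q, HasDerivAt φ (φ' x) x) (hφ' : ∀ x ∈ Icc p q, HasDerivAt φ' (φ'' x) x)
    (hφ'' : ContinuousOn φ'' (Icc p q)) (hge : ∀ x ∈ Icc p q, l ≤ φ'' x) (hq : φ' q ≤ 0) :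
    ‖∫ x in p..q, Complex.exp (φ x * Complex.I)‖ ≤ 5 / √l := by
  have hmem {x : ℝ} (hx : x ∈ Icc (-q) (-p)) : -x ∈ Icc p q :=
    ⟨le_neg_of_le_neg hx.2, neg_le_of_neg_le hx.1⟩
  rw [← neg_neg p, ← neg_neg q, ← intervalIntegral.integral_comp_neg
    (f := fun x => Complex.exp (φ x * Complex.I))]
  refine norm_integral_cexp_le_of_le_deriv2_of_nonneg (φ := fun x => φ (-x))
    (φ' := fun x => -φ' (-x)) (φ'' := fun x => φ'' (-x)) (neg_le_neg hpq) hl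
    (fun x hx => ?_) (fun x hx => ?_) ?_ (fun x hx => hge _ (hmem hx)) (by simpa using hq)
  · exact ((hφ _ (hmem hx)).comp x (hasDerivAt_neg x)).congr_deriv (by ring)
  · exact ((hφ' _ (hmem hx)).comp x (hasDerivAt_neg x)).fun_neg.congr_deriv (by ring)
  · exact hφ''.comp continuousOn_neg fun x hx => hmem hx

theorem norm_integral_cexp_le_of_le_deriv2 (hpq : p ≤ q) (hl : 0 < l)
    (hφ : ∀ x ∈ Icc p q, HasDerivAt φ (φ' x) x) (hφ' : ∀ x ∈ Icc p q, HasDerivAt φ' (φ'' x) x)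
    (hφ'' : ContinuousOn φ'' (Icc p q)) (hge : ∀ x ∈ Icc p q, l ≤ φ'' x) :
    ‖∫ x in p..q, Complex.exp (φ x * Complex.I)‖ ≤ 10 / √l := by
  have hweaken : 5 / √l ≤ 10 / √l := by gcongr; norm_num
  rcases le_or_gt 0 (φ' p) with hp | hp
  · exact (norm_integral_cexp_le_of_le_deriv2_of_nonneg hpq hl hφ hφ' hφ'' hge hp).trans hweaken
  rcases le_or_gt (φ' q) 0 with hq | hq
  · exact (norm_integral_cexp_le_of_le_deriv2_of_nonpos hpq hl hφ hφ' hφ'' hge hq).trans hweaken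
  obtain ⟨c, hc, hc0⟩ :=
    intermediate_value_Icc hpq (HasDerivAt.continuousOn hφ') ⟨hp.le, hq.le⟩
  have hleft : Icc p c ⊆ Icc p q := Icc_subset_Icc_right hc.2
  have hright : Icc c q ⊆ Icc p q := Icc_subset_Icc_left hc.1
  have hexp := continuousOn_cexp_mul_I hφ
  rw [← intervalIntegral.integral_add_adjacent_intervals
    ((hexp.mono hleft).intervalIntegrable_of_Icc hc.1)
    ((hexp.mono hright).intervalIntegrable_of_Icc hc.2)]
  calc _ ≤ 5 / √l + 5 / √l := (norm_add_le _ _).trans (add_le_add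
        (norm_integral_cexp_le_of_le_deriv2_of_nonpos hc.1 hl (fun x hx => hφ x (hleft hx))
          (fun x hx => hφ' x (hleft hx)) (hφ''.mono hleft) (fun x hx => hge x (hleft hx)) hc0.le)
        (norm_integral_cexp_le_of_le_deriv2_of_nonneg hc.2 hl (fun x hx => hφ x (hright hx))
          (fun x hx => hφ' x (hright hx)) (hφ''.mono hright)
          (fun x hx => hge x (hright hx)) hc0.ge))
    _ = 10 / √l := by ring

end VanDerCorput

theorem norm_integral_mul_le_of_norm_primitive_le {e b b' : ℝ → ℂ} {p q M B B' : ℝ} (hpq : p ≤ q)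
    (he : Continuous e) (hM : ∀ x ∈ Icc p q, ‖∫ y in p..x, e y‖ ≤ M)
    (hb : ∀ x ∈ Icc p q, HasDerivAt b (b' x) x) (hb'c : ContinuousOn b' (Icc p q))
    (hbq : ‖b q‖ ≤ B) (hb' : ∀ x ∈ Icc p q, ‖b' x‖ ≤ B') :
    ‖∫ x in p..q, e x * b x‖ ≤ M * (B + B' * (q - p)) := by
  have hparts : ∫ x in p..q, b x * e x =
      b q * (∫ y in p..q, e y) - b p * (∫ y in p..p, e y) - ∫ x in p..q, b' x * ∫ y in p..x, e y :=
    intervalIntegral.integral_mul_deriv_eq_deriv_mul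
      (fun x hx => hb x (uIcc_of_le hpq ▸ hx))
      (fun x _ => he.integral_hasStrictDerivAt p x |>.hasDerivAt)
      (hb'c.intervalIntegrable_of_Icc hpq) (he.intervalIntegrable _ _)
  have hboundary : ‖b q * ∫ y in p..q, e y‖ ≤ B * M :=
    norm_mul_le_of_le hbq (hM q (right_mem_Icc.2 hpq))
  have hinterior : ‖∫ x in p..q, b' x * ∫ y in p..x, e y‖ ≤ B' * M * |q - p| := by
    refine intervalIntegral.norm_integral_le_of_norm_le_const fun x hx => ?_
    have hx' : x ∈ Icc p q := Ioc_subset_Icc_self (uIoc_of_le hpq ▸ hx)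
    exact norm_mul_le_of_le (hb' x hx') (hM x hx')
  rw [abs_of_nonneg (sub_nonneg.2 hpq)] at hinterior
  simp_rw [mul_comm (e _)]
  rw [hparts, intervalIntegral.integral_same, mul_zero, sub_zero]
  linarith [norm_sub_le (b q * ∫ y in p..q, e y) (∫ x in p..q, b' x * ∫ y in p..x, e y)]

section PowerPhase

variable {α : ℝ}

theorem hasDerivAt_powerPhase (t Y : ℝ) {x : ℝ} (hx : 0 < x) :
    HasDerivAt (fun ρ : ℝ => t * ρ ^ α + Y * ρ) (t * (α * x ^ (α - 1)) + Y) x := by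
  simpa using ((Real.hasDerivAt_rpow_const (p := α) (Or.inl hx.ne')).const_mul t).fun_add
    ((hasDerivAt_id x).const_mul Y)

theorem hasDerivAt_deriv_powerPhase (t Y : ℝ) {x : ℝ} (hx : 0 < x) :
    HasDerivAt (fun ρ : ℝ => t * (α * ρ ^ (α - 1)) + Y) (-t * (α * (1 - α) * x ^ (α - 2))) x := by
  refine ((((Real.hasDerivAt_rpow_const (p := α - 1) (Or.inl hx.ne')).const_mul α).const_mul
    t).add_const Y).congr_deriv ?_
  rw [show α - 1 - 1 = α - 2 by ring]
  ring

theorem continuousOn_deriv2_powerPhase (t : ℝ) {a b : ℝ} (ha : 0 < a) :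
    ContinuousOn (fun ρ : ℝ => -t * (α * (1 - α) * ρ ^ (α - 2))) (Icc a b) :=
  continuousOn_const.mul (continuousOn_const.mul
    (continuousOn_id.rpow_const fun _ hx => Or.inl (ha.trans_le hx.1).ne'))

theorem norm_integral_powerPhase_le_of_small_time (hα0 : 0 < α) (hα1 : α < 1) {a b t Y : ℝ}
    (ha : 0 < a) (hab : a ≤ b) (ht : t ≤ 0) (hY : Y ≠ 0)
    (hsmall : -t * (α * a ^ (α - 1)) ≤ |Y| / 2) :
    ‖∫ ρ in a..b, Complex.exp ((t * ρ ^ α + Y * ρ : ℝ) * Complex.I)‖ ≤ 8 / |Y| := by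
  have hpos {x : ℝ} (hx : x ∈ Icc a b) : 0 < x := ha.trans_le hx.1
  have : 0 < 1 - α := sub_pos.2 hα1
  have ht' : 0 ≤ -t := neg_nonneg.2 ht
  refine (norm_integral_cexp_le_of_le_abs_deriv (l := |Y| / 2) hab (by positivity)
    (fun x hx => hasDerivAt_powerPhase t Y (hpos hx))
    (fun x hx => hasDerivAt_deriv_powerPhase t Y (hpos hx)) (continuousOn_deriv2_powerPhase t ha)
    (fun x hx => ?_) (fun x hx => ?_)).trans_eq (by ring)
  · have := hpos hx
    positivity
  · have hdecreasing : x ^ (α - 1) ≤ a ^ (α - 1) :=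
      Real.rpow_le_rpow_of_nonpos ha hx.1 (by linarith)
    have hdominated : |t * (α * x ^ (α - 1))| ≤ |Y| / 2 := by
      have := Real.rpow_nonneg (hpos hx).le (α - 1)
      rw [abs_mul, abs_of_nonpos ht, abs_of_nonneg (by positivity)]
      exact le_trans (by gcongr) hsmall
    rw [add_comm]
    linarith [abs_sub_abs_le_abs_add Y (t * (α * x ^ (α - 1)))]

theorem norm_integral_powerPhase_le_of_neg_time (hα0 : 0 < α) (hα1 : α < 1) {a b t : ℝ}
    (ha : 0 < a) (hab : a ≤ b) (ht : t < 0) (Y : ℝ) :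
    ‖∫ ρ in a..b, Complex.exp ((t * ρ ^ α + Y * ρ : ℝ) * Complex.I)‖ ≤
      10 / √(-t * (α * (1 - α) * b ^ (α - 2))) := by
  have hpos {x : ℝ} (hx : x ∈ Icc a b) : 0 < x := ha.trans_le hx.1
  have : 0 < 1 - α := sub_pos.2 hα1
  have ht' : 0 < -t := neg_pos.2 ht
  have hb : 0 < b := ha.trans_le hab
  refine norm_integral_cexp_le_of_le_deriv2 hab (by positivity)
    (fun x hx => hasDerivAt_powerPhase t Y (hpos hx))
    (fun x hx => hasDerivAt_deriv_powerPhase t Y (hpos hx)) (continuousOn_deriv2_powerPhase t ha)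
    fun x hx => ?_
  gcongr _ * (_ * ?_)
  exact Real.rpow_le_rpow_of_nonpos (hpos hx) hx.2 (by linarith)

theorem exists_norm_integral_powerPhase_le_of_nonpos (hα0 : 0 < α) (hα1 : α < 1) {a : ℝ}
    (ha : 0 < a) (b : ℝ) :
    ∃ M : ℝ, ∀ t ≤ 0, ∀ Y : ℝ, 1 ≤ |Y| → ∀ x ∈ Icc a b,
      ‖∫ ρ in a..x, Complex.exp ((t * ρ ^ α + Y * ρ : ℝ) * Complex.I)‖ ≤ M / √|Y| := by
  have h1α : 0 < 1 - α := sub_pos.2 hα1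
  set l := (1 - α) * b ^ (α - 2) / (2 * a ^ (α - 1))
  refine ⟨8 + 10 / √l, fun t ht Y hY x hx => ?_⟩
  have hY0 : 0 < |Y| := one_pos.trans_le hY
  have hx0 : 0 < x := ha.trans_le hx.1
  have hb0 : 0 < b := hx0.trans_le hx.2
  rw [add_div, div_div]
  -- Either the linear part of the phase dominates its derivative, or `|t|` is at least a multiple
  -- of `|Y|` and the second derivative is large.
  rcases le_or_gt (-t * (α * a ^ (α - 1))) (|Y| / 2) with hsmall | hlarge
  · calc _ ≤ 8 / |Y| := norm_integral_powerPhase_le_of_small_time hα0 hα1 ha hx.1 ht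
          (abs_pos.1 hY0) hsmall
      _ ≤ 8 / √|Y| := by
          gcongr
          exact Real.sqrt_le_iff.2 ⟨by positivity, by nlinarith⟩
      _ ≤ _ := le_add_of_nonneg_right (by positivity)
  · have ht0 : t < 0 := ht.lt_of_ne fun h => by simp [h] at hlarge; linarith
    have hl : 0 < l := by positivity
    have hcurvature : l * |Y| ≤ -t * (α * (1 - α) * x ^ (α - 2)) := by
      calc l * |Y| = (|Y| / 2) * ((1 - α) * b ^ (α - 2) / a ^ (α - 1)) := by ring
        _ ≤ (-t * (α * a ^ (α - 1))) * ((1 - α) * b ^ (α - 2) / a ^ (α - 1)) := by gcongr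
        _ = -t * (α * (1 - α) * b ^ (α - 2)) := by field_simp
        _ ≤ -t * (α * (1 - α) * x ^ (α - 2)) := by
            have : 0 ≤ -t := neg_nonneg.2 ht
            gcongr _ * (_ * ?_)
            exact Real.rpow_le_rpow_of_nonpos hx0 hx.2 (by linarith)
    calc _ ≤ 10 / √(-t * (α * (1 - α) * x ^ (α - 2))) :=
          norm_integral_powerPhase_le_of_neg_time hα0 hα1 ha hx.1 ht0 Y
      _ ≤ 10 / √(l * |Y|) := by gcongr
      _ = 10 / (√l * √|Y|) := by rw [Real.sqrt_mul hl.le]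
      _ ≤ _ := le_add_of_nonneg_left (by positivity)

theorem norm_integral_cexp_neg_phase (φ : ℝ → ℝ) (a b : ℝ) :
    ‖∫ ρ in a..b, Complex.exp ((-φ ρ : ℝ) * Complex.I)‖ =
      ‖∫ ρ in a..b, Complex.exp (φ ρ * Complex.I)‖ := by
  rw [← RCLike.norm_conj, ← intervalIntegral.intervalIntegral_conj]
  simp [← Complex.exp_conj]

theorem exists_norm_integral_powerPhase_le (hα0 : 0 < α) (hα1 : α < 1) {a : ℝ}
    (ha : 0 < a) (b : ℝ) :
    ∃ M : ℝ, ∀ t Y : ℝ, 1 ≤ |Y| → ∀ x ∈ Icc a b,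
      ‖∫ ρ in a..x, Complex.exp ((t * ρ ^ α + Y * ρ : ℝ) * Complex.I)‖ ≤ M / √|Y| := by
  obtain ⟨M, hM⟩ := exists_norm_integral_powerPhase_le_of_nonpos hα0 hα1 ha b
  refine ⟨M, fun t Y hY x hx => ?_⟩
  rcases le_total t 0 with ht | ht
  · exact hM t ht Y hY x hx
  · have := hM (-t) (neg_nonpos.2 ht) (-Y) (by rwa [abs_neg]) x hx
    rw [abs_neg] at this
    rw [← norm_integral_cexp_neg_phase]
    convert this using 7
    ring

end PowerPhase

/-- `h` is a harmonic oscillator with an inverse-square perturbation, `h'' + h = (c / r ^ 2) h`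
on `(0, ∞)`, with derivative `h'`. -/
structure IsPerturbedOscillator (c : ℝ) (h h' : ℝ → ℝ) : Prop where
  hasDerivAt : ∀ r, 0 < r → HasDerivAt h (h' r) r
  hasDerivAt_deriv : ∀ r, 0 < r → HasDerivAt h' (-h r + c / r ^ 2 * h r) r

/-- The slowly varying coefficient of `exp (i ε r)`, for `ε = ±1`, in the decomposition of an
oscillator `h` with derivative `h'` into an outgoing and an incoming wave. -/
noncomputable def waveAmplitude (h h' : ℝ → ℝ) (ε r : ℝ) : ℂ :=
  Complex.exp (-(ε * r : ℝ) * Complex.I) * (h r - ε * h' r * Complex.I) / 2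

/-- The derivative of `waveAmplitude h h'` when `h'' + h = (c / r ^ 2) h`. -/
noncomputable def waveAmplitudeDeriv (c : ℝ) (h : ℝ → ℝ) (ε r : ℝ) : ℂ :=
  Complex.exp (-(ε * r : ℝ) * Complex.I) * (-(ε * (c / r ^ 2 * h r) : ℝ) * Complex.I) / 2

theorem exp_mul_waveAmplitude (h h' : ℝ → ℝ) (ε r : ℝ) :
    Complex.exp ((ε * r : ℝ) * Complex.I) * waveAmplitude h h' ε r =
      (h r - ε * h' r * Complex.I) / 2 := by
  rw [waveAmplitude, mul_div_assoc, ← mul_assoc, ← Complex.exp_add]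
  simp

theorem norm_waveAmplitude_le {h h' : ℝ → ℝ} {ε r A : ℝ} (hε : |ε| = 1) (hh : |h r| ≤ A)
    (hh' : |h' r| ≤ A) : ‖waveAmplitude h h' ε r‖ ≤ A := by
  have hexp := Complex.norm_exp_ofReal_mul_I (-(ε * r))
  rw [Complex.ofReal_neg] at hexp
  have hsub : ‖(h r : ℂ) - ε * h' r * Complex.I‖ ≤ A + A := by
    refine (norm_sub_le _ _).trans (add_le_add ?_ ?_)
    · simpa using hh
    · simpa [hε] using hh'
  rw [waveAmplitude, norm_div, norm_mul, hexp, one_mul, Complex.norm_two]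
  linarith

theorem norm_waveAmplitudeDeriv_le {c ε r A : ℝ} {h : ℝ → ℝ} (hε : |ε| = 1) (hh : |h r| ≤ A) :
    ‖waveAmplitudeDeriv c h ε r‖ ≤ |c| * A / r ^ 2 := by
  have hexp := Complex.norm_exp_ofReal_mul_I (-(ε * r))
  rw [Complex.ofReal_neg] at hexp
  have hforce : ‖(-(ε * (c / r ^ 2 * h r) : ℝ) : ℂ) * Complex.I‖ = |c| * |h r| / r ^ 2 := by
    rw [norm_mul, norm_neg, Complex.norm_I, Complex.norm_real, Real.norm_eq_abs, abs_mul, abs_mul,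
      abs_div, hε, abs_of_nonneg (sq_nonneg r)]
    ring
  have hmul : |c| * |h r| / r ^ 2 ≤ |c| * A / r ^ 2 := by gcongr
  have hnonneg : 0 ≤ |c| * |h r| / r ^ 2 := by positivity
  rw [waveAmplitudeDeriv, norm_div, norm_mul, hexp, hforce, one_mul, Complex.norm_two]
  linarith

theorem ofReal_eq_add_waves (h h' : ℝ → ℝ) (r : ℝ) : (h r : ℂ) =
    Complex.exp ((1 * r : ℝ) * Complex.I) * waveAmplitude h h' 1 r +
      Complex.exp ((-1 * r : ℝ) * Complex.I) * waveAmplitude h h' (-1) r := by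
  rw [exp_mul_waveAmplitude, exp_mul_waveAmplitude]
  push_cast
  ring

namespace IsPerturbedOscillator

variable {c : ℝ} {h h' : ℝ → ℝ}

theorem sq_add_sq_le (hh : IsPerturbedOscillator c h h') {r₀ r : ℝ} (hr₀ : 0 < r₀) (hr : r₀ ≤ r) :
    h r ^ 2 + h' r ^ 2 ≤ (h r₀ ^ 2 + h' r₀ ^ 2) * Real.exp (|c| * r₀⁻¹) := by
  -- The weight turns the energy, whose growth rate is at most `|c| / r ^ 2`, into a decreasing one.
  set E : ℝ → ℝ := fun r => (h r ^ 2 + h' r ^ 2) * Real.exp (|c| * r⁻¹)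
  have hderiv (r : ℝ) (hr : 0 < r) : HasDerivAt E
      (Real.exp (|c| * r⁻¹) / r ^ 2 * (c * (2 * h r * h' r) - |c| * (h r ^ 2 + h' r ^ 2))) r := by
    refine ((((hh.hasDerivAt r hr).fun_pow 2).fun_add
      ((hh.hasDerivAt_deriv r hr).fun_pow 2)).fun_mul
      ((hasDerivAt_inv hr.ne').const_mul |c|).exp).congr_deriv ?_
    field_simp
    ring
  have hpos {x : ℝ} (hx : x ∈ Ici r₀) : 0 < x := hr₀.trans_le hx
  have hanti : AntitoneOn E (Ici r₀) := by
    refine antitoneOn_of_hasDerivWithinAt_nonpos (convex_Ici _)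
      (fun x hx => (hderiv x (hpos hx)).continuousAt.continuousWithinAt)
      (fun x hx => (hderiv x (hpos (interior_subset hx))).hasDerivWithinAt) fun x _ => ?_
    have hcross : |2 * h x * h' x| ≤ h x ^ 2 + h' x ^ 2 :=
      abs_le.2 ⟨by nlinarith [sq_nonneg (h x + h' x)], by nlinarith [sq_nonneg (h x - h' x)]⟩
    refine mul_nonpos_of_nonneg_of_nonpos (by positivity) (sub_nonpos.2 ?_)
    calc c * (2 * h x * h' x) ≤ |c| * |2 * h x * h' x| := by
          rw [← abs_mul]
          exact le_abs_self _
      _ ≤ |c| * (h x ^ 2 + h' x ^ 2) := by gcongr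
  calc h r ^ 2 + h' r ^ 2 ≤ E r :=
        le_mul_of_one_le_right (by positivity)
          (Real.one_le_exp (by have := hpos hr; positivity))
    _ ≤ E r₀ := hanti self_mem_Ici hr hr

theorem exists_abs_le (hh : IsPerturbedOscillator c h h') {r₀ : ℝ} (hr₀ : 0 < r₀) :
    ∃ A : ℝ, 0 ≤ A ∧ ∀ r, r₀ ≤ r → |h r| ≤ A ∧ |h' r| ≤ A := by
  refine ⟨√((h r₀ ^ 2 + h' r₀ ^ 2) * Real.exp (|c| * r₀⁻¹)), Real.sqrt_nonneg _,
    fun r hr => ⟨?_, ?_⟩⟩ <;>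
  exact Real.abs_le_sqrt (by linarith [hh.sq_add_sq_le hr₀ hr, sq_nonneg (h r), sq_nonneg (h' r)])

theorem hasDerivAt_waveAmplitude (hh : IsPerturbedOscillator c h h') {ε r : ℝ} (hε : |ε| = 1)
    (hr : 0 < r) :
    HasDerivAt (waveAmplitude h h' ε) (waveAmplitudeDeriv c h ε r) r := by
  have hε2 : (ε : ℂ) ^ 2 = 1 := by
    exact_mod_cast (sq_abs ε).symm.trans (by rw [hε, one_pow])
  have hexp : HasDerivAt (fun r : ℝ => Complex.exp (-(ε * r : ℝ) * Complex.I)) _ r :=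
    (((hasDerivAt_id r).const_mul ε).ofReal_comp.fun_neg.mul_const Complex.I).cexp
  have hfactor := (hh.hasDerivAt r hr).ofReal_comp.fun_sub
    ((((hh.hasDerivAt_deriv r hr).ofReal_comp).const_mul (ε : ℂ)).mul_const Complex.I)
  refine ((hexp.fun_mul hfactor).div_const 2).congr_deriv ?_
  rw [waveAmplitudeDeriv]
  simp only [id, mul_one]
  push_cast
  linear_combination (1 / 2 : ℂ) * Complex.exp (-(ε * r) * Complex.I) * h' r *
    (Complex.I ^ 2 * hε2 + Complex.I_sq)

theorem continuousOn (hh : IsPerturbedOscillator c h h') : ContinuousOn h (Ioi 0) :=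
  HasDerivAt.continuousOn fun r hr => hh.hasDerivAt r hr

theorem continuousOn_waveAmplitudeDeriv (hh : IsPerturbedOscillator c h h') (ε : ℝ) :
    ContinuousOn (waveAmplitudeDeriv c h ε) (Ioi 0) := by
  have hforce : ContinuousOn (fun r : ℝ => ε * (c / r ^ 2 * h r)) (Ioi 0) :=
    continuousOn_const.mul ((continuousOn_const.div (by fun_prop)
      fun r hr => pow_ne_zero _ (ne_of_gt hr)).mul hh.continuousOn)
  exact ((by fun_prop : ContinuousOn (fun r : ℝ => Complex.exp (-(ε * r : ℝ) * Complex.I)) _).mul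
    ((Complex.continuous_ofReal.comp_continuousOn hforce).neg.mul continuousOn_const)).div_const _

theorem hasDerivAt_waveAmplitude_dilate (hh : IsPerturbedOscillator c h h') {ε x X : ℝ}
    (hε : |ε| = 1) (hx : 0 < x) (hX : 0 < X) :
    HasDerivAt (fun ρ => waveAmplitude h h' ε (ρ * X))
      (waveAmplitudeDeriv c h ε (x * X) * X) x := by
  refine ((hh.hasDerivAt_waveAmplitude hε (mul_pos hx hX)).scomp x
    ((hasDerivAt_id x).mul_const X)).congr_deriv ?_
  simp [mul_comm]

theorem exists_norm_waveAmplitude_dilate_le (hh : IsPerturbedOscillator c h h') {a : ℝ}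
    (ha : 0 < a) :
    ∃ A : ℝ, ∀ ε : ℝ, |ε| = 1 → ∀ x X : ℝ, a ≤ x → 1 ≤ X →
      ‖waveAmplitude h h' ε (x * X)‖ ≤ A ∧ ‖waveAmplitudeDeriv c h ε (x * X) * X‖ ≤ A := by
  obtain ⟨A, hA0, hA⟩ := hh.exists_abs_le ha
  refine ⟨max A (|c| * A / a ^ 2), fun ε hε x X hx hX => ?_⟩
  have hx0 : 0 < x := ha.trans_le hx
  have hX0 : 0 < X := one_pos.trans_le hX
  obtain ⟨hAh, hAh'⟩ := hA (x * X) (hx.trans (le_mul_of_one_le_right hx0.le hX))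
  refine ⟨(norm_waveAmplitude_le hε hAh hAh').trans (le_max_left _ _), ?_⟩
  calc ‖waveAmplitudeDeriv c h ε (x * X) * X‖ ≤ |c| * A / (x * X) ^ 2 * X := by
        rw [norm_mul, Complex.norm_real, Real.norm_of_nonneg hX0.le]
        gcongr
        exact norm_waveAmplitudeDeriv_le hε hAh
    _ = |c| * A / x ^ 2 / X := by field_simp
    _ ≤ |c| * A / a ^ 2 / 1 := by gcongr
    _ ≤ max A (|c| * A / a ^ 2) := by rw [div_one]; exact le_max_right _ _

theorem exists_norm_integral_wave_le (hh : IsPerturbedOscillator c h h') {α : ℝ} (hα0 : 0 < α)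
    (hα1 : α < 1) {a b : ℝ} (ha : 0 < a) (hab : a ≤ b) {g g' : ℝ → ℂ}
    (hg : ∀ x ∈ Icc a b, HasDerivAt g (g' x) x) (hg' : ContinuousOn g' (Icc a b)) {ε : ℝ}
    (hε : |ε| = 1) :
    ∃ C : ℝ, ∀ t X : ℝ, 1 ≤ X →
      ‖∫ ρ in a..b, Complex.exp ((t * ρ ^ α + ε * X * ρ : ℝ) * Complex.I) *
        (g ρ * waveAmplitude h h' ε (ρ * X))‖ ≤ C / √X := by
  obtain ⟨A, hA⟩ := hh.exists_norm_waveAmplitude_dilate_le ha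
  obtain ⟨M, hM⟩ := exists_norm_integral_powerPhase_le hα0 hα1 ha b
  have hgc : ContinuousOn g (Icc a b) := HasDerivAt.continuousOn hg
  obtain ⟨G, hG⟩ := isCompact_Icc.exists_bound_of_continuousOn hgc
  obtain ⟨G', hG'⟩ := isCompact_Icc.exists_bound_of_continuousOn hg'
  refine ⟨M * (G * A + (G' * A + G * A) * (b - a)), fun t X hX => ?_⟩
  have hX0 : 0 < X := one_pos.trans_le hX
  have hpos {x : ℝ} (hx : x ∈ Icc a b) : 0 < x := ha.trans_le hx.1
  have hgA {x : ℝ} (hx : x ∈ Icc a b) : ‖g x * waveAmplitude h h' ε (x * X)‖ ≤ G * A :=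
    norm_mul_le_of_le (hG x hx) (hA ε hε x X hx.1 hX).1
  have hg'A {x : ℝ} (hx : x ∈ Icc a b) : ‖g' x * waveAmplitude h h' ε (x * X)‖ ≤ G' * A :=
    norm_mul_le_of_le (hG' x hx) (hA ε hε x X hx.1 hX).1
  have hgA' {x : ℝ} (hx : x ∈ Icc a b) :
      ‖g x * (waveAmplitudeDeriv c h ε (x * X) * X)‖ ≤ G * A :=
    norm_mul_le_of_le (hG x hx) (hA ε hε x X hx.1 hX).2
  have hdilate {x : ℝ} (hx : x ∈ Icc a b) :=
    hh.hasDerivAt_waveAmplitude_dilate hε (hpos hx) hX0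
  have hX_abs : |ε * X| = X := by rw [abs_mul, hε, one_mul, abs_of_pos hX0]
  refine (norm_integral_mul_le_of_norm_primitive_le (M := M / √X) hab
    (by have := Real.continuous_rpow_const hα0.le; fun_prop)
    (fun x hx => (hM t (ε * X) (by rwa [hX_abs]) x hx).trans_eq (by rw [hX_abs]))
    (fun x hx => (hg x hx).fun_mul (hdilate hx)) ?_
    (hgA (right_mem_Icc.2 hab)) fun x hx =>
      (norm_add_le _ _).trans (add_le_add (hg'A hx) (hgA' hx))).trans_eq (by ring)
  refine (hg'.mul (HasDerivAt.continuousOn fun x hx => hdilate hx)).add (hgc.mul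
    (((hh.continuousOn_waveAmplitudeDeriv ε).comp (by fun_prop) fun x hx => ?_).mul
      continuousOn_const))
  exact mul_pos (hpos hx) hX0

theorem exists_norm_integral_le (hh : IsPerturbedOscillator c h h') {α : ℝ} (hα0 : 0 < α)
    (hα1 : α < 1) {a b : ℝ} (ha : 0 < a) (hab : a ≤ b) {g g' : ℝ → ℂ}
    (hg : ∀ x ∈ Icc a b, HasDerivAt g (g' x) x) (hg' : ContinuousOn g' (Icc a b)) :
    ∃ C : ℝ, ∀ t X : ℝ, 1 ≤ X →
      ‖∫ ρ in a..b, Complex.exp ((t * ρ ^ α : ℝ) * Complex.I) * (g ρ * h (ρ * X))‖ ≤ C / √X := by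
  obtain ⟨C₁, hC₁⟩ := hh.exists_norm_integral_wave_le hα0 hα1 ha hab hg hg' (ε := 1) (by simp)
  obtain ⟨C₂, hC₂⟩ := hh.exists_norm_integral_wave_le hα0 hα1 ha hab hg hg' (ε := -1) (by simp)
  refine ⟨C₁ + C₂, fun t X hX => ?_⟩
  have hintegrable (ε : ℝ) (hε : |ε| = 1) : IntervalIntegrable (fun ρ : ℝ =>
      Complex.exp ((t * ρ ^ α + ε * X * ρ : ℝ) * Complex.I) *
        (g ρ * waveAmplitude h h' ε (ρ * X))) volume a b := by
    have hexp : Continuous fun ρ : ℝ =>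
        Complex.exp ((t * ρ ^ α + ε * X * ρ : ℝ) * Complex.I) := by
      have := Real.continuous_rpow_const hα0.le
      fun_prop
    refine (hexp.continuousOn.mul ((HasDerivAt.continuousOn hg).mul
      (HasDerivAt.continuousOn fun x hx => hh.hasDerivAt_waveAmplitude_dilate hε
        (ha.trans_le hx.1) (one_pos.trans_le hX)))).intervalIntegrable_of_Icc hab
  have hsplit (ρ : ℝ) : Complex.exp ((t * ρ ^ α : ℝ) * Complex.I) * (g ρ * h (ρ * X)) =
      Complex.exp ((t * ρ ^ α + 1 * X * ρ : ℝ) * Complex.I) *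
        (g ρ * waveAmplitude h h' 1 (ρ * X)) +
      Complex.exp ((t * ρ ^ α + -1 * X * ρ : ℝ) * Complex.I) *
        (g ρ * waveAmplitude h h' (-1) (ρ * X)) := by
    rw [ofReal_eq_add_waves h h' (ρ * X)]
    simp only [Complex.ofReal_add, add_mul, Complex.exp_add, mul_assoc, mul_comm X ρ]
    ring
  simp_rw [hsplit]
  rw [intervalIntegral.integral_add (hintegrable 1 (by simp)) (hintegrable (-1) (by simp)), add_div]
  exact (norm_add_le _ _).trans (add_le_add (hC₁ t X hX) (hC₂ t X hX))

end IsPerturbedOscillator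

/-- `J` is, up to a power of `r`, a Bessel function: `J'' + (2m/r) J' + J = 0` on `(0, ∞)`, where
`J'` is the derivative of `J`. -/
structure IsBesselProfile (m : ℝ) (J J' : ℝ → ℝ) : Prop where
  hasDerivAt : ∀ r, 0 < r → HasDerivAt J (J' r) r
  hasDerivAt_deriv : ∀ r, 0 < r → HasDerivAt J' (-J r - 2 * m / r * J' r) r

theorem IsBesselProfile.isPerturbedOscillator {m : ℝ} {J J' : ℝ → ℝ} (hJ : IsBesselProfile m J J') :
    IsPerturbedOscillator (m * (m - 1)) (fun r => r ^ m * J r)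
      fun r => r ^ m * (m * r⁻¹ * J r + J' r) := by
  have hrpow (r : ℝ) (hr : 0 < r) : HasDerivAt (fun r : ℝ => r ^ m) (r ^ m * (m * r⁻¹)) r := by
    refine (Real.hasDerivAt_rpow_const (p := m) (Or.inl hr.ne')).congr_deriv ?_
    rw [Real.rpow_sub_one hr.ne']
    ring
  constructor <;> intro r hr
  · refine ((hrpow r hr).fun_mul (hJ.hasDerivAt r hr)).congr_deriv ?_
    ring
  · refine ((hrpow r hr).fun_mul ((((hasDerivAt_inv hr.ne').const_mul m).fun_mul
      (hJ.hasDerivAt r hr)).fun_add (hJ.hasDerivAt_deriv r hr))).congr_deriv ?_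
    field_simp
    ring

theorem isBesselProfile_cos : IsBesselProfile 0 Real.cos fun r => -Real.sin r where
  hasDerivAt r _ := Real.hasDerivAt_cos r
  hasDerivAt_deriv r _ := by simpa using (Real.hasDerivAt_sin r).fun_neg

section PoissonIntegral

/-- Poisson's integral for the Bessel function of order `k / 2`, without the factor `r ^ (k / 2)`.
-/
noncomputable def poissonIntegral (k : ℕ) (r : ℝ) : ℝ :=
  ∫ θ in (0 : ℝ)..Real.pi, Real.cos (r * Real.cos θ) * Real.sin θ ^ k

/-- The derivative of `poissonIntegral k`. -/
noncomputable def poissonIntegralDeriv (k : ℕ) (r : ℝ) : ℝ :=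
  ∫ θ in (0 : ℝ)..Real.pi, -Real.sin (r * Real.cos θ) * (Real.cos θ * Real.sin θ ^ k)

theorem hasDerivAt_intervalIntegral_comp_mul_mul {φ φ' u w : ℝ → ℝ}
    (hφ : ∀ x, HasDerivAt φ (φ' x) x) (hφ' : Continuous φ') {B : ℝ} (hB : ∀ x, |φ' x| ≤ B)
    (hu : Continuous u) (hw : Continuous w) (a b r : ℝ) :
    HasDerivAt (fun r => ∫ θ in a..b, φ (r * u θ) * w θ)
      (∫ θ in a..b, φ' (r * u θ) * (u θ * w θ)) r := by
  have hφc : Continuous φ := continuous_iff_continuousAt.2 fun x => (hφ x).continuousAt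
  refine (intervalIntegral.hasDerivAt_integral_of_dominated_loc_of_deriv_le
    (bound := fun θ => B * |u θ * w θ|) (F' := fun r θ => φ' (r * u θ) * (u θ * w θ))
    Filter.univ_mem ?_ ?_ ?_ ?_ ?_ ?_).2
  · exact Filter.Eventually.of_forall fun x => Continuous.aestronglyMeasurable (by fun_prop)
  · exact Continuous.intervalIntegrable (by fun_prop) _ _
  · exact Continuous.aestronglyMeasurable (by fun_prop)
  · refine Filter.Eventually.of_forall fun θ _ x _ => ?_
    rw [Real.norm_eq_abs, abs_mul]
    gcongr
    exact hB _
  · exact Continuous.intervalIntegrable (by fun_prop) _ _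
  · refine Filter.Eventually.of_forall fun θ _ x _ => ?_
    refine (((hφ (x * u θ)).comp x (hasDerivAt_mul_const (u θ))).mul_const (w θ)).congr_deriv ?_
    ring

theorem mul_integral_cos_mul_sq_eq (k : ℕ) (r : ℝ) :
    r * (∫ θ in (0 : ℝ)..Real.pi,
      -Real.cos (r * Real.cos θ) * (Real.cos θ * (Real.cos θ * Real.sin θ ^ k))) =
      -r * poissonIntegral k r - (k + 1) * poissonIntegralDeriv k r := by
  have hexact : ∫ θ in (0 : ℝ)..Real.pi, (Real.cos (r * Real.cos θ) * (r * -Real.sin θ) *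
      Real.sin θ ^ (k + 1) + Real.sin (r * Real.cos θ) *
        (((k + 1 : ℕ) : ℝ) * Real.sin θ ^ k * Real.cos θ)) = 0 := by
    rw [intervalIntegral.integral_eq_sub_of_hasDerivAt
      (f := fun θ => Real.sin (r * Real.cos θ) * Real.sin θ ^ (k + 1)) _
      (Continuous.intervalIntegrable (by fun_prop) _ _)]
    · simp
    · exact fun θ _ => (((Real.hasDerivAt_cos θ).const_mul r).sin).fun_mul
        ((Real.hasDerivAt_sin θ).fun_pow (k + 1))
  have hpoint (θ : ℝ) : Real.cos (r * Real.cos θ) * (r * -Real.sin θ) * Real.sin θ ^ (k + 1) +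
      Real.sin (r * Real.cos θ) * (((k + 1 : ℕ) : ℝ) * Real.sin θ ^ k * Real.cos θ) =
      -r * (-Real.cos (r * Real.cos θ) * (Real.cos θ * (Real.cos θ * Real.sin θ ^ k))) +
      -r * (Real.cos (r * Real.cos θ) * Real.sin θ ^ k) +
      -(k + 1) * (-Real.sin (r * Real.cos θ) * (Real.cos θ * Real.sin θ ^ k)) := by
    push_cast
    linear_combination (-r * Real.cos (r * Real.cos θ) * Real.sin θ ^ k) *
      Real.sin_sq_add_cos_sq θ
  simp_rw [hpoint] at hexact
  rw [intervalIntegral.integral_add, intervalIntegral.integral_add,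
    intervalIntegral.integral_const_mul, intervalIntegral.integral_const_mul,
    intervalIntegral.integral_const_mul] at hexact
  · rw [poissonIntegral, poissonIntegralDeriv]
    linear_combination -hexact
  all_goals exact Continuous.intervalIntegrable (by fun_prop) _ _

theorem isBesselProfile_poissonIntegral (k : ℕ) :
    IsBesselProfile ((k + 1) / 2) (poissonIntegral k) (poissonIntegralDeriv k) where
  hasDerivAt r _ := hasDerivAt_intervalIntegral_comp_mul_mul Real.hasDerivAt_cos
    (by fun_prop) (B := 1) (fun x => by rw [abs_neg]; exact Real.abs_sin_le_one x)
    Real.continuous_cos (by fun_prop) _ _ r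
  hasDerivAt_deriv r hr := by
    refine (hasDerivAt_intervalIntegral_comp_mul_mul (fun x => (Real.hasDerivAt_sin x).fun_neg)
      (by fun_prop) (B := 1) (fun x => by rw [abs_neg]; exact Real.abs_cos_le_one x)
      Real.continuous_cos (by fun_prop) _ _ r).congr_deriv (mul_left_cancel₀ hr.ne' ?_)
    rw [mul_integral_cos_mul_sq_eq]
    field_simp

end PoissonIntegral

section RadialFourier

theorem integral_inner_norm_eq_integral_prod {E : Type*} [NormedAddCommGroup E] [NormedSpace ℝ E]
    (n : ℕ) (x : Rd (n + 1)) (F : ℝ → ℝ → E) :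
    ∫ ξ : Rd (n + 1), F (inner ℝ x ξ) ‖ξ‖ =
      ∫ p : ℝ × Rd n, F (‖x‖ * p.1) √(p.1 ^ 2 + ‖p.2‖ ^ 2) := by
  have hfinrank : Module.finrank ℝ (Rd (n + 1)) = Module.finrank ℝ (WithLp 2 (ℝ × Rd n)) := by
    rw [(WithLp.linearEquiv 2 ℝ (ℝ × Rd n)).finrank_eq]
    simp [add_comm]
  let Φ : Rd (n + 1) ≃ₗᵢ[ℝ] WithLp 2 (ℝ × Rd n) :=
    (stdOrthonormalBasis ℝ (Rd (n + 1))).repr.trans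
      ((stdOrthonormalBasis ℝ (WithLp 2 (ℝ × Rd n))).reindex (finCongr hfinrank.symm)).repr.symm
  set w : WithLp 2 (ℝ × Rd n) := WithLp.toLp 2 (‖x‖, 0) with hw
  have hnorm : ‖Φ x‖ = ‖w‖ := by
    rw [Φ.norm_map, hw, WithLp.prod_norm_eq_of_L2]
    simp
  let Ψ := Φ.trans (Submodule.reflection (Submodule.span ℝ {Φ x - w})ᗮ)
  have hΨ : Ψ x = w := Submodule.reflection_sub hnorm
  calc ∫ ξ : Rd (n + 1), F (inner ℝ x ξ) ‖ξ‖
      = ∫ y : WithLp 2 (ℝ × Rd n), F (inner ℝ w y) ‖y‖ := by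
        rw [← Ψ.measurePreserving.integral_comp Ψ.toHomeomorph.measurableEmbedding]
        simp_rw [← hΨ, Ψ.inner_map_map, Ψ.norm_map]
    _ = ∫ p : ℝ × Rd n, F (‖x‖ * p.1) √(p.1 ^ 2 + ‖p.2‖ ^ 2) := by
        rw [← (WithLp.volume_preserving_toLp ℝ (Rd n)).integral_comp
          (MeasurableEquiv.toLp 2 (ℝ × Rd n)).measurableEmbedding]
        simp [hw, WithLp.prod_inner_apply, WithLp.prod_norm_eq_of_L2, mul_comm]

theorem polarCoord_symm_mem_upperHalfPlane_iff {p : ℝ × ℝ} (hp : p ∈ polarCoord.target) :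
    polarCoord.symm p ∈ (univ : Set ℝ) ×ˢ Ioi (0 : ℝ) ↔ p ∈ Ioi (0 : ℝ) ×ˢ Ioo 0 Real.pi := by
  obtain ⟨hr, hlower, hupper⟩ := hp
  rw [mem_Ioi] at hr
  simp only [polarCoord_symm_apply, mem_prod, mem_univ, true_and, mem_Ioi, mem_Ioo, hr, hupper,
    and_true, mul_pos_iff_of_pos_left hr]
  refine ⟨fun hsin => ?_, fun hpos => Real.sin_pos_of_pos_of_lt_pi hpos hupper⟩
  by_contra! hneg
  exact hsin.not_ge (Real.sin_nonpos_of_nonpos_of_neg_pi_le hneg hlower.le)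

theorem setIntegral_upperHalfPlane_eq_polarCoord {E : Type*} [NormedAddCommGroup E]
    [NormedSpace ℝ E] (H : ℝ × ℝ → E) :
    ∫ p in (univ : Set ℝ) ×ˢ Ioi (0 : ℝ), H p =
      ∫ p in Ioi (0 : ℝ) ×ˢ Ioo 0 Real.pi, p.1 • H (polarCoord.symm p) := by
  have hsubset : Ioi (0 : ℝ) ×ˢ Ioo (0 : ℝ) Real.pi ⊆ polarCoord.target :=
    prod_mono Subset.rfl (Ioo_subset_Ioo_left (by linarith [Real.pi_pos]))
  rw [← integral_indicator (MeasurableSet.univ.prod measurableSet_Ioi),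
    ← integral_comp_polarCoord_symm, ← inter_eq_self_of_subset_right hsubset,
    ← setIntegral_indicator (measurableSet_Ioi.prod measurableSet_Ioo)]
  refine setIntegral_congr_fun polarCoord.open_target.measurableSet fun p hp => ?_
  simp only [indicator_apply, polarCoord_symm_mem_upperHalfPlane_iff hp, smul_ite, smul_zero]

theorem integrable_mul_comp_sqrt_sq_add_sq {E : Type*} [NormedAddCommGroup E] [ProperSpace E]
    [MeasurableSpace E] [OpensMeasurableSpace (ℝ × E)] {μ : Measure (ℝ × E)}
    [IsFiniteMeasureOnCompacts μ] {w : ℝ × E → ℂ} (hw : Continuous w) {g : ℝ → ℂ}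
    (hg : Continuous g) {b : ℝ} (hgb : ∀ ρ, b < ρ → g ρ = 0) :
    Integrable (fun p => w p * g √(p.1 ^ 2 + ‖p.2‖ ^ 2)) μ := by
  refine Continuous.integrable_of_hasCompactSupport (by fun_prop)
    (HasCompactSupport.intro (isCompact_closedBall (0 : ℝ × E) b) fun p hp => ?_)
  have hnorm : ‖p‖ ≤ √(p.1 ^ 2 + ‖p.2‖ ^ 2) :=
    max_le (Real.le_sqrt_of_sq_le (by rw [Real.norm_eq_abs, sq_abs]; linarith [sq_nonneg ‖p.2‖]))
      (Real.le_sqrt_of_sq_le (by linarith [sq_nonneg p.1]))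
  rw [mem_closedBall_zero_iff, not_le] at hp
  rw [hgb _ (hp.trans_le hnorm), mul_zero]

variable {g : ℝ → ℂ} {b : ℝ}

theorem integral_cos_inner_mul_eq_setIntegral_upperHalfPlane (k : ℕ) (hg : Continuous g)
    (hgb : ∀ ρ, b < ρ → g ρ = 0) (x : Rd (k + 2)) :
    ∫ ξ : Rd (k + 2), (Real.cos (inner ℝ x ξ) : ℂ) * g ‖ξ‖ =
      ((k + 1 : ℕ) * volume.real (ball (0 : Rd (k + 1)) 1) : ℝ) *
        ∫ p in (univ : Set ℝ) ×ˢ Ioi (0 : ℝ),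
          (p.2 : ℂ) ^ k * (Real.cos (‖x‖ * p.1) * g √(p.1 ^ 2 + p.2 ^ 2)) := by
  have hslice (u : ℝ) :
      ∫ v : Rd (k + 1), (Real.cos (‖x‖ * u) : ℂ) * g √(u ^ 2 + ‖v‖ ^ 2) =
        ((k + 1 : ℕ) * volume.real (ball (0 : Rd (k + 1)) 1) : ℝ) *
          ∫ y in Ioi (0 : ℝ), (y : ℂ) ^ k * (Real.cos (‖x‖ * u) * g √(u ^ 2 + y ^ 2)) := by
    rw [integral_fun_norm_addHaar (volume : Measure (Rd (k + 1)))
      fun y : ℝ => (Real.cos (‖x‖ * u) : ℂ) * g √(u ^ 2 + y ^ 2), finrank_euclideanSpace_fin]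
    simp [Complex.real_smul, mul_assoc]
  have hsqrt (p : ℝ × ℝ) : (p.2 : ℂ) ^ k * (Real.cos (‖x‖ * p.1) * g √(p.1 ^ 2 + p.2 ^ 2)) =
      (p.2 : ℂ) ^ k * Real.cos (‖x‖ * p.1) * g √(p.1 ^ 2 + ‖p.2‖ ^ 2) := by
    rw [Real.norm_eq_abs, sq_abs, mul_assoc]
  rw [integral_inner_norm_eq_integral_prod (k + 1) x fun a ρ => (Real.cos a : ℂ) * g ρ,
    Measure.volume_eq_prod,
    integral_prod _ (integrable_mul_comp_sqrt_sq_add_sq (by fun_prop) hg hgb),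
    Measure.volume_eq_prod, setIntegral_prod _ (by
      simp_rw [hsqrt]
      exact (integrable_mul_comp_sqrt_sq_add_sq (by fun_prop) hg hgb).integrableOn),
    Measure.restrict_univ]
  simp_rw [hslice]
  rw [integral_const_mul]

theorem setIntegral_upperHalfPlane_cos_mul_eq (k : ℕ) (hg : Continuous g)
    (hgb : ∀ ρ, b < ρ → g ρ = 0) (X : ℝ) :
    ∫ p in (univ : Set ℝ) ×ˢ Ioi (0 : ℝ),
        (p.2 : ℂ) ^ k * (Real.cos (X * p.1) * g √(p.1 ^ 2 + p.2 ^ 2)) =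
      ∫ ρ in Ioi (0 : ℝ), (ρ : ℂ) ^ (k + 1) * (g ρ * poissonIntegral k (ρ * X)) := by
  set H : ℝ × ℝ → ℂ := fun p => (p.1 : ℂ) ^ (k + 1) *
    (g p.1 * ((Real.cos (p.1 * X * Real.cos p.2) * Real.sin p.2 ^ k : ℝ) : ℂ)) with hH
  have hpolar : ∫ p in (univ : Set ℝ) ×ˢ Ioi (0 : ℝ),
      (p.2 : ℂ) ^ k * (Real.cos (X * p.1) * g √(p.1 ^ 2 + p.2 ^ 2)) =
      ∫ p in Ioi (0 : ℝ) ×ˢ Ioo 0 Real.pi, H p := by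
    rw [setIntegral_upperHalfPlane_eq_polarCoord]
    refine setIntegral_congr_fun (measurableSet_Ioi.prod measurableSet_Ioo) fun p hp => ?_
    have hsqrt : √((p.1 * Real.cos p.2) ^ 2 + (p.1 * Real.sin p.2) ^ 2) = p.1 := by
      rw [mul_pow, mul_pow, ← mul_add, Real.cos_sq_add_sin_sq, mul_one]
      exact Real.sqrt_sq (mem_Ioi.1 hp.1).le
    simp only [hH, polarCoord_symm_apply, hsqrt, Complex.real_smul,
      show X * (p.1 * Real.cos p.2) = p.1 * X * Real.cos p.2 by ring]
    push_cast
    ring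
  have hH_integrable : IntegrableOn H (Ioi (0 : ℝ) ×ˢ Ioo 0 Real.pi) := by
    refine ((by fun_prop : Continuous H).continuousOn.integrableOn_compact
      (isCompact_Icc.prod (isCompact_Icc (a := 0) (b := Real.pi)))).of_forall_sdiff_eq_zero
      (s := Icc 0 b ×ˢ Icc 0 Real.pi) (measurableSet_Ioi.prod measurableSet_Ioo) ?_
    rintro p ⟨⟨hr, hθ⟩, hnot⟩
    have hlarge : b < p.1 := by
      by_contra! hle
      exact hnot ⟨⟨(mem_Ioi.1 hr).le, hle⟩, Ioo_subset_Icc_self hθ⟩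
    simp [hH, hgb _ hlarge]
  rw [hpolar, Measure.volume_eq_prod, setIntegral_prod _ hH_integrable]
  refine setIntegral_congr_fun measurableSet_Ioi fun ρ _ => ?_
  simp only [hH]
  rw [integral_const_mul, integral_const_mul, poissonIntegral,
    intervalIntegral.integral_of_le Real.pi_pos.le, integral_Ioc_eq_integral_Ioo,
    integral_complex_ofReal]

theorem integral_cos_inner_mul_eq_integral_cos (g : ℝ → ℂ) (x : Rd 1) :
    ∫ ξ : Rd 1, (Real.cos (inner ℝ x ξ) : ℂ) * g ‖ξ‖ =
      volume.real (ball (0 : Rd 1) 1) * ∫ ρ in Ioi (0 : ℝ), g ρ * Real.cos (ρ * ‖x‖) := by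
  have hcos (ξ : Rd 1) : Real.cos (inner ℝ x ξ) = Real.cos (‖ξ‖ * ‖x‖) := by
    rw [← Real.cos_abs]
    simp [EuclideanSpace.norm_eq, Real.sqrt_sq_eq_abs, PiLp.inner_apply, abs_mul]
  simp_rw [hcos, mul_comm _ (g _)]
  rw [integral_fun_norm_addHaar (volume : Measure (Rd 1)) fun ρ : ℝ =>
    g ρ * (Real.cos (ρ * ‖x‖) : ℂ), finrank_euclideanSpace_fin]
  simp

theorem exists_integral_cos_inner_eq_integral_besselProfile {d : ℕ} (hd : 1 ≤ d) (b : ℝ) :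
    ∃ (c : ℝ) (J J' : ℝ → ℝ), IsBesselProfile (((d : ℝ) - 1) / 2) J J' ∧
      ∀ g : ℝ → ℂ, Continuous g → (∀ ρ, b < ρ → g ρ = 0) → ∀ x : Rd d,
        ∫ ξ : Rd d, (Real.cos (inner ℝ x ξ) : ℂ) * g ‖ξ‖ =
          c * ∫ ρ in Ioi (0 : ℝ), (ρ : ℂ) ^ (d - 1) * (g ρ * J (ρ * ‖x‖)) := by
  obtain rfl | ⟨k, rfl⟩ : d = 1 ∨ ∃ k, d = k + 2 :=
    hd.eq_or_lt'.imp id fun h => ⟨d - 2, by omega⟩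
  · refine ⟨volume.real (ball (0 : Rd 1) 1), _, _, by simpa using isBesselProfile_cos,
      fun g _ _ x => ?_⟩
    simpa using integral_cos_inner_mul_eq_integral_cos g x
  · have hindex : ((k : ℝ) + 1) / 2 = (((k + 2 : ℕ) : ℝ) - 1) / 2 := by push_cast; ring
    refine ⟨(k + 1 : ℕ) * volume.real (ball (0 : Rd (k + 1)) 1), _, _,
      hindex ▸ isBesselProfile_poissonIntegral k, fun g hg hgb x => ?_⟩
    rw [integral_cos_inner_mul_eq_setIntegral_upperHalfPlane k hg hgb,
      setIntegral_upperHalfPlane_cos_mul_eq k hg hgb]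
    rfl

end RadialFourier

theorem norm_le_sum_abs_inner {ι E : Type*} [Fintype ι] [NormedAddCommGroup E]
    [InnerProductSpace ℝ E] (b : OrthonormalBasis ι ℝ E) (w : E) : ‖w‖ ≤ ∑ j, |inner ℝ w (b j)| :=
  calc ‖w‖ = ‖∑ j, inner ℝ (b j) w • b j‖ := by rw [b.sum_repr']
    _ ≤ ∑ j, ‖inner ℝ (b j) w • b j‖ := norm_sum_le _ _
    _ = ∑ j, |inner ℝ w (b j)| := by simp [norm_smul, real_inner_comm]

section OscillatoryIntegral

variable {E : Type*} [NormedAddCommGroup E] [InnerProductSpace ℝ E] [MeasurableSpace E]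
  [BorelSpace E] [FiniteDimensional ℝ E]

/-- The oscillatory integral with phase `⟪w, ξ⟫ + t φ(ξ)` and amplitude `a`: the value at `w` of the
kernel of `exp (i t φ(D)) a(D)`, up to normalization. -/
noncomputable def oscillatoryIntegral (φ : E → ℝ) (a : E → ℂ) (t : ℝ) (w : E) : ℂ :=
  ∫ ξ, Complex.exp ((inner ℝ w ξ + t * φ ξ : ℝ) * Complex.I) * a ξ

variable {φ : E → ℝ} {a : E → ℂ}

theorem norm_oscillatoryIntegral_le (φ : E → ℝ) (a : E → ℂ) (t : ℝ) (w : E) :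
    ‖oscillatoryIntegral φ a t w‖ ≤ ∫ ξ, ‖a ξ‖ :=
  (norm_integral_le_integral_norm _).trans_eq <| by
    simp_rw [norm_mul, Complex.norm_exp_ofReal_mul_I, one_mul]

theorem oscillatoryIntegral_eq_integral_cos (hφ : Continuous φ) (ha : Integrable a)
    (hφ_even : ∀ ξ, φ (-ξ) = φ ξ) (ha_even : ∀ ξ, a (-ξ) = a ξ) (t : ℝ) (w : E) :
    oscillatoryIntegral φ a t w =
      ∫ ξ, (Real.cos (inner ℝ w ξ) : ℂ) * (Complex.exp ((t * φ ξ : ℝ) * Complex.I) * a ξ) := by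
  have hintegrable (s : ℝ) : Integrable fun ξ =>
      Complex.exp ((s * inner ℝ w ξ + t * φ ξ : ℝ) * Complex.I) * a ξ :=
    ha.bdd_mul (c := 1) (Continuous.aestronglyMeasurable (by fun_prop))
      (Filter.Eventually.of_forall fun ξ => (Complex.norm_exp_ofReal_mul_I _).le)
  have hreflect : oscillatoryIntegral φ a t w =
      ∫ ξ, Complex.exp ((-1 * inner ℝ w ξ + t * φ ξ : ℝ) * Complex.I) * a ξ := by
    rw [oscillatoryIntegral, ← integral_neg_eq_self]
    simp_rw [inner_neg_right, hφ_even, ha_even, neg_one_mul]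
  have hcos (ξ : E) : (Real.cos (inner ℝ w ξ) : ℂ) *
      (Complex.exp ((t * φ ξ : ℝ) * Complex.I) * a ξ) =
      (1 / 2 : ℂ) * (Complex.exp ((1 * inner ℝ w ξ + t * φ ξ : ℝ) * Complex.I) * a ξ +
        Complex.exp ((-1 * inner ℝ w ξ + t * φ ξ : ℝ) * Complex.I) * a ξ) := by
    simp only [Complex.ofReal_cos, Complex.cos, Complex.ofReal_add, Complex.ofReal_mul,
      Complex.ofReal_neg, one_mul, add_mul, neg_mul,
      Complex.exp_add]
    ring
  simp_rw [hcos]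
  rw [integral_const_mul, integral_add (hintegrable 1) (hintegrable (-1)), ← hreflect]
  simp_rw [one_mul, oscillatoryIntegral]
  ring

theorem abs_inner_mul_norm_oscillatoryIntegral_le (hφ : ContDiff ℝ 1 φ) (ha : ContDiff ℝ 1 a)
    (hac : HasCompactSupport a) (v : E) (t : ℝ) (w : E) :
    |inner ℝ w v| * ‖oscillatoryIntegral φ a t w‖ ≤
      ‖oscillatoryIntegral φ (fun ξ => fderiv ℝ a ξ v) t w‖ +
        |t| * ‖oscillatoryIntegral φ (fun ξ => fderiv ℝ φ ξ v * a ξ) t w‖ := by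
  set e : E → ℂ := fun ξ => Complex.exp ((inner ℝ w ξ + t * φ ξ : ℝ) * Complex.I) with he
  have hφc := hφ.continuous
  have hφ'c : Continuous fun ξ => fderiv ℝ φ ξ v := by fun_prop
  have hec : Continuous e := by fun_prop
  have he_deriv (ξ : E) : HasFDerivAt e
      (e ξ • (Complex.I • Complex.ofRealCLM.comp (innerSL ℝ w + t • fderiv ℝ φ ξ))) ξ :=
    ((Complex.ofRealCLM.hasFDerivAt.comp ξ ((innerSL ℝ w).hasFDerivAt.fun_add
      ((hφ.differentiable one_ne_zero ξ).hasFDerivAt.const_mul t))).mul_const Complex.I).cexp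
  have he'_apply (ξ : E) : fderiv ℝ e ξ v * a ξ = Complex.I * inner ℝ w v * (e ξ * a ξ) +
      Complex.I * t * (e ξ * (fderiv ℝ φ ξ v * a ξ)) := by
    rw [(he_deriv ξ).fderiv]
    simp only [FunLike.coe_smul, Pi.smul_apply, ContinuousLinearMap.comp_apply, FunLike.coe_add,
      Pi.add_apply, innerSL_apply_apply, Complex.ofRealCLM_apply, smul_eq_mul,
      Complex.ofReal_add, Complex.ofReal_mul]
    ring
  have hintegrable {b : E → ℂ} (hb : Continuous b) (hbc : HasCompactSupport b) :
      Integrable fun ξ => e ξ * b ξ :=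
    (hec.mul hb).integrable_of_hasCompactSupport hbc.mul_left
  have ha_int := hintegrable ha.continuous hac
  have hφa_int : Integrable fun ξ => e ξ * (fderiv ℝ φ ξ v * a ξ) :=
    hintegrable ((Complex.continuous_ofReal.comp hφ'c).mul ha.continuous) hac.mul_left
  have hparts := integral_mul_fderiv_eq_neg_fderiv_mul_of_integrable (μ := volume) (v := v)
    (f := e) (g := a)
    (by simp_rw [he'_apply]; exact (ha_int.const_mul _).add (hφa_int.const_mul _))
    (hintegrable (by fun_prop) (hac.fderiv_apply ℝ v)) ha_int
    (fun ξ _ => (he_deriv ξ).differentiableAt) fun ξ _ => ha.differentiable one_ne_zero ξ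
  simp_rw [he'_apply] at hparts
  rw [integral_add (ha_int.const_mul _) (hφa_int.const_mul _), integral_const_mul,
    integral_const_mul] at hparts
  calc |inner ℝ w v| * ‖oscillatoryIntegral φ a t w‖
      = ‖Complex.I * inner ℝ w v * ∫ ξ, e ξ * a ξ‖ := by
        simp [he, oscillatoryIntegral]
    _ = ‖-(∫ ξ, e ξ * fderiv ℝ a ξ v) -
          Complex.I * t * ∫ ξ, e ξ * (fderiv ℝ φ ξ v * a ξ)‖ := by
        rw [hparts]
        ring_nf
    _ ≤ _ := (norm_sub_le _ _).trans_eq (by simp [he, oscillatoryIntegral])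

theorem one_add_norm_mul_norm_oscillatoryIntegral_le {ι : Type*} [Fintype ι]
    (b : OrthonormalBasis ι ℝ E) (hφ : ContDiff ℝ 1 φ) (ha : ContDiff ℝ 1 a)
    (hac : HasCompactSupport a) (t : ℝ) (w : E) :
    (1 + ‖w‖) * ‖oscillatoryIntegral φ a t w‖ ≤ ‖oscillatoryIntegral φ a t w‖ +
      ∑ j, (‖oscillatoryIntegral φ (fun ξ => fderiv ℝ a ξ (b j)) t w‖ +
        |t| * ‖oscillatoryIntegral φ (fun ξ => fderiv ℝ φ ξ (b j) * a ξ) t w‖) := by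
  rw [add_mul, one_mul]
  gcongr
  calc ‖w‖ * ‖oscillatoryIntegral φ a t w‖
      ≤ (∑ j, |inner ℝ w (b j)|) * ‖oscillatoryIntegral φ a t w‖ := by
        gcongr
        exact norm_le_sum_abs_inner b w
    _ ≤ _ := by
        rw [Finset.sum_mul]
        exact Finset.sum_le_sum fun j _ =>
          abs_inner_mul_norm_oscillatoryIntegral_le hφ ha hac (b j) t w

theorem exists_one_add_norm_pow_mul_norm_oscillatoryIntegral_le (hφ : ContDiff ℝ ∞ φ)
    (ha : ContDiff ℝ ∞ a) (hac : HasCompactSupport a) (N : ℕ) :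
    ∃ C : ℝ, 0 ≤ C ∧ ∀ (t : ℝ) (w : E),
      (1 + ‖w‖) ^ N * ‖oscillatoryIntegral φ a t w‖ ≤ C * (1 + |t|) ^ N := by
  induction N generalizing a with
  | zero =>
    exact ⟨∫ ξ, ‖a ξ‖, integral_nonneg fun _ => norm_nonneg _, fun t w => by
      simpa using norm_oscillatoryIntegral_le φ a t w⟩
  | succ N ih =>
    let b := stdOrthonormalBasis ℝ E
    have hφ' (v : E) : ContDiff ℝ ∞ fun ξ => fderiv ℝ φ ξ v :=
      (hφ.fderiv_right (m := ∞) (by simp)).clm_apply contDiff_const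
    obtain ⟨C₀, hC₀, h₀⟩ := ih ha hac
    choose C₁ hC₁ h₁ using fun j =>
      ih ((ha.fderiv_right (m := ∞) (by simp)).clm_apply contDiff_const)
        (hac.fderiv_apply ℝ (b j))
    choose C₂ hC₂ h₂ using fun j =>
      ih (a := fun ξ => fderiv ℝ φ ξ (b j) * a ξ)
        ((Complex.ofRealCLM.contDiff.comp (hφ' (b j))).mul ha) hac.mul_left
    have hsum₁ := Finset.univ.sum_nonneg fun j _ => hC₁ j
    have hsum₂ := Finset.univ.sum_nonneg fun j _ => hC₂ j
    refine ⟨C₀ + ∑ j, C₁ j + ∑ j, C₂ j, by positivity, fun t w => ?_⟩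
    calc (1 + ‖w‖) ^ (N + 1) * ‖oscillatoryIntegral φ a t w‖
        = (1 + ‖w‖) ^ N * ((1 + ‖w‖) * ‖oscillatoryIntegral φ a t w‖) := by ring
      _ ≤ _ := mul_le_mul_of_nonneg_left (one_add_norm_mul_norm_oscillatoryIntegral_le b
          (hφ.of_le (by simp)) (ha.of_le (by simp)) hac t w) (by positivity)
      _ ≤ C₀ * (1 + |t|) ^ N +
            ∑ j, (C₁ j * (1 + |t|) ^ N + |t| * (C₂ j * (1 + |t|) ^ N)) := by
          rw [mul_add, Finset.mul_sum]
          refine add_le_add (h₀ t w) (Finset.sum_le_sum fun j _ => ?_)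
          rw [mul_add, mul_left_comm]
          exact add_le_add (h₁ j t w) (mul_le_mul_of_nonneg_left (h₂ j t w) (abs_nonneg t))
      _ = (C₀ + ∑ j, C₁ j + |t| * ∑ j, C₂ j) * (1 + |t|) ^ N := by
          rw [Finset.sum_add_distrib, ← Finset.mul_sum, ← Finset.sum_mul, ← Finset.sum_mul]
          ring
      _ ≤ ((C₀ + ∑ j, C₁ j + ∑ j, C₂ j) * (1 + |t|)) * (1 + |t|) ^ N := by
          have := mul_nonneg (add_nonneg hC₀ hsum₁) (abs_nonneg t)
          gcongr
          linarith
      _ = _ := by ring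

end OscillatoryIntegral

section AnnulusKernel

variable {d : ℕ}

theorem setIntegral_pow_mul_dilate_eq {E : ℝ → ℂ} {g : ℝ → ℂ} {J : ℝ → ℝ} (hd : 1 ≤ d) {a b : ℝ}
    (ha : 0 < a) (hab : a ≤ b) (hg : ∀ ρ, 0 ≤ ρ → ρ ∉ Ioc a b → g ρ = 0) {X : ℝ} (hX : 0 < X) :
    ∫ ρ in Ioi (0 : ℝ), (ρ : ℂ) ^ (d - 1) * (E ρ * g ρ * J (ρ * X)) =
      (X ^ (-(((d : ℝ) - 1) / 2)) : ℝ) * ∫ ρ in a..b, E ρ * ((ρ ^ (((d : ℝ) - 1) / 2) : ℝ) * g ρ *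
        ((ρ * X) ^ (((d : ℝ) - 1) / 2) * J (ρ * X) : ℝ)) := by
  set m : ℝ := ((d : ℝ) - 1) / 2 with hm
  have hsub : Ioc a b ⊆ Ioi 0 := fun ρ hρ => ha.trans hρ.1
  rw [intervalIntegral.integral_of_le hab, ← integral_const_mul,
    setIntegral_eq_of_subset_of_forall_sdiff_eq_zero measurableSet_Ioi hsub
      fun ρ hρ => by rw [hg ρ (mem_Ioi.1 hρ.1).le hρ.2]; ring]
  refine setIntegral_congr_fun measurableSet_Ioc fun ρ hρ => ?_
  have hρ0 : 0 < ρ := hsub hρ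
  have hpow : ρ ^ (d - 1) = ρ ^ m * ρ ^ m := by
    rw [← Real.rpow_add hρ0, ← Real.rpow_natCast, Nat.cast_sub hd, hm]
    ring_nf
  have hcancel : X ^ (-m) * X ^ m = 1 := by rw [← Real.rpow_add hX, neg_add_cancel, Real.rpow_zero]
  have hweight : ρ ^ (d - 1) * J (ρ * X) =
      X ^ (-m) * (ρ ^ m * ((ρ * X) ^ m * J (ρ * X))) := by
    rw [Real.mul_rpow hρ0.le hX.le, hpow]
    linear_combination (-(ρ ^ m * ρ ^ m * J (ρ * X))) * hcancel
  have := congrArg ((↑) : ℝ → ℂ) hweight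
  push_cast at this ⊢
  linear_combination (E ρ * g ρ) * this

theorem exists_norm_oscillatoryIntegral_rpow_le (hd : 1 ≤ d) {α : ℝ} (hα0 : 0 < α) (hα1 : α < 1)
    {g : ℝ → ℂ} (hg : ContDiff ℝ 1 g) {a b : ℝ} (ha : 0 < a) (hab : a ≤ b)
    (hg0 : ∀ ρ, 0 ≤ ρ → ρ ∉ Ioc a b → g ρ = 0) :
    ∃ C : ℝ, ∀ (t : ℝ) (w : Rd d), 1 ≤ ‖w‖ →
      ‖oscillatoryIntegral (fun ξ => ‖ξ‖ ^ α) (fun ξ => g ‖ξ‖) t w‖ ≤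
        C * ‖w‖ ^ (-((d : ℝ) / 2)) := by
  obtain ⟨c, J, J', hJ, hbessel⟩ := exists_integral_cos_inner_eq_integral_besselProfile hd b
  set m : ℝ := ((d : ℝ) - 1) / 2 with hm
  have hweight : ContDiffOn ℝ 1 (fun ρ : ℝ => ((ρ ^ m : ℝ) : ℂ) * g ρ) (Ioi 0) :=
    (Complex.ofRealCLM.contDiff.comp_contDiffOn
      (contDiffOn_id.rpow_const_of_ne fun ρ hρ => (ne_of_gt hρ))).mul hg.contDiffOn
  have hsub : Icc a b ⊆ Ioi 0 := fun ρ hρ => ha.trans_le hρ.1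
  obtain ⟨C, hC⟩ := hJ.isPerturbedOscillator.exists_norm_integral_le hα0 hα1 ha hab
    (fun ρ hρ => ((hweight.differentiableOn one_ne_zero).differentiableAt
      (Ioi_mem_nhds (hsub hρ))).hasDerivAt)
    ((hweight.continuousOn_deriv_of_isOpen isOpen_Ioi le_rfl).mono hsub)
  have hgc := hg.continuous
  have hcont := Real.continuous_rpow_const hα0.le
  have hsupport : HasCompactSupport fun ξ : Rd d => g ‖ξ‖ :=
    HasCompactSupport.intro (isCompact_closedBall 0 b) fun ξ hξ =>
      hg0 _ (norm_nonneg ξ) fun hξb => hξ (mem_closedBall_zero_iff.2 hξb.2)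
  have hintegrable : Integrable fun ξ : Rd d => g ‖ξ‖ :=
    Continuous.integrable_of_hasCompactSupport (by fun_prop) hsupport
  refine ⟨|c| * C, fun t w hw => ?_⟩
  have hw0 : 0 < ‖w‖ := one_pos.trans_le hw
  have hexponent : ‖w‖ ^ (-((d : ℝ) / 2)) = ‖w‖ ^ (-m) * (1 / √‖w‖) := by
    rw [Real.sqrt_eq_rpow, one_div, ← Real.rpow_neg hw0.le, ← Real.rpow_add hw0, hm]
    ring_nf
  rw [oscillatoryIntegral_eq_integral_cos (by fun_prop) hintegrable (by simp) (by simp),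
    hbessel (fun ρ => Complex.exp ((t * ρ ^ α : ℝ) * Complex.I) * g ρ) (by fun_prop)
      (fun ρ hρ => by
        rw [hg0 ρ ((ha.trans_le hab).trans hρ).le fun h => hρ.not_ge h.2, mul_zero]) w,
    setIntegral_pow_mul_dilate_eq hd ha hab hg0 hw0, norm_mul, norm_mul, Complex.norm_real,
    Complex.norm_real, Real.norm_eq_abs, Real.norm_of_nonneg (by positivity), hexponent]
  calc |c| * (‖w‖ ^ (-m) * _) ≤ |c| * (‖w‖ ^ (-m) * (C / √‖w‖)) := by
        gcongr
        exact hC t ‖w‖ hw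
    _ = _ := by ring

/-- A smooth cutoff on `ℝ`, equal to `1` on `[1, 4]` and vanishing off `(1 / 2, 9 / 2)`. Evaluated
at `‖ξ‖ ^ 2`, it localizes smoothly to a neighbourhood of the annulus `1 ≤ ‖ξ‖ ≤ 2`. -/
noncomputable def squaredAnnulusBump : ContDiffBump (5 / 2 : ℝ) :=
  ⟨3 / 2, 2, by norm_num, by norm_num⟩

theorem squaredAnnulusBump_eq_one {r : ℝ} (h1 : 1 ≤ r) (h4 : r ≤ 4) : squaredAnnulusBump r = 1 :=
  squaredAnnulusBump.one_of_mem_closedBall <| by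
    rw [Real.closedBall_eq_Icc]
    norm_num [squaredAnnulusBump, h1, h4]

theorem squaredAnnulusBump_eq_zero {r : ℝ} (h : r ∉ Ioo (1 / 2 : ℝ) (9 / 2)) :
    squaredAnnulusBump r = 0 :=
  squaredAnnulusBump.zero_of_le_dist <| by
    rw [← not_lt, ← mem_ball, Real.ball_eq_Ioo]
    norm_num [squaredAnnulusBump] at h ⊢
    exact h

/-- The kernel of `exp (i t |D| ^ α)` localized to frequencies of size about one, up to
normalization. -/
noncomputable def annulusKernel (α t : ℝ) (w : Rd d) : ℂ :=
  oscillatoryIntegral (fun ξ => ‖ξ‖ ^ α) (fun ξ => (squaredAnnulusBump (‖ξ‖ ^ 2) : ℂ)) t w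

theorem exists_contDiff_eq_norm_rpow (E : Type*) [NormedAddCommGroup E] [InnerProductSpace ℝ E]
    (α : ℝ) {r : ℝ} (hr : 0 < r) :
    ∃ φ : E → ℝ, ContDiff ℝ ∞ φ ∧ ∀ ξ, r ≤ ‖ξ‖ ^ 2 → φ ξ = ‖ξ‖ ^ α := by
  let s (u : ℝ) : ℝ := Real.smoothTransition (2 / r * u - 1)
  have hs : ContDiff ℝ ∞ s :=
    Real.smoothTransition.contDiff.comp ((contDiff_const.mul contDiff_id).sub contDiff_const)
  -- `q` is a positive smooth function with `q u = u` for `r ≤ u`.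
  let q (u : ℝ) : ℝ := s u * u + (1 - s u)
  have hq : ContDiff ℝ ∞ q := (hs.mul contDiff_id).add (contDiff_const.sub hs)
  have hqpos (u : ℝ) : 0 < q u := by
    have h0 : 0 ≤ s u := Real.smoothTransition.nonneg _
    have h1 : s u ≤ 1 := Real.smoothTransition.le_one _
    rcases le_or_gt u 0 with h | h
    · have hs0 : s u = 0 := Real.smoothTransition.zero_of_nonpos <| by
        have := mul_nonpos_of_nonneg_of_nonpos (by positivity : 0 ≤ 2 / r) h
        linarith
      simp [q, hs0]
    · rcases h1.lt_or_eq with h1 | h1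
      · exact add_pos_of_nonneg_of_pos (mul_nonneg h0 h.le) (sub_pos.2 h1)
      · simpa [q, h1] using h
  refine ⟨fun ξ => q (‖ξ‖ ^ 2) ^ (α / 2),
    (hq.comp (contDiff_norm_sq ℝ)).rpow_const_of_ne fun ξ => (hqpos _).ne', fun ξ hξ => ?_⟩
  have hs1 : s (‖ξ‖ ^ 2) = 1 := Real.smoothTransition.one_of_one_le <| by
    rw [le_sub_iff_add_le, div_mul_eq_mul_div, le_div_iff₀ hr]
    linarith
  simp only [q, hs1, one_mul, sub_self, add_zero]
  rw [← Real.rpow_natCast, ← Real.rpow_mul (norm_nonneg _)]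
  congr 1
  push_cast
  ring

theorem hasCompactSupport_annulusBump :
    HasCompactSupport fun ξ : Rd d => (squaredAnnulusBump (‖ξ‖ ^ 2) : ℂ) :=
  HasCompactSupport.intro (isCompact_closedBall 0 3) fun ξ hξ => by
    rw [mem_closedBall_zero_iff, not_le] at hξ
    rw [squaredAnnulusBump_eq_zero fun h => by nlinarith [h.2], Complex.ofReal_zero]

theorem exists_one_add_norm_pow_mul_norm_annulusKernel_le (d : ℕ) (α : ℝ) (N : ℕ) :
    ∃ C : ℝ, 0 ≤ C ∧ ∀ (t : ℝ) (w : Rd d),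
      (1 + ‖w‖) ^ N * ‖annulusKernel α t w‖ ≤ C * (1 + |t|) ^ N := by
  obtain ⟨φ, hφ, hφα⟩ := exists_contDiff_eq_norm_rpow (Rd d) α (r := 1 / 2) (by norm_num)
  have hkernel (t : ℝ) (w : Rd d) : annulusKernel α t w =
      oscillatoryIntegral φ (fun ξ => (squaredAnnulusBump (‖ξ‖ ^ 2) : ℂ)) t w := by
    refine integral_congr_ae (Filter.Eventually.of_forall fun ξ => ?_)
    rcases le_or_gt (1 / 2) (‖ξ‖ ^ 2) with h | h
    · simp only [hφα ξ h]
    · simp only [squaredAnnulusBump_eq_zero fun h' => h'.1.not_gt h, Complex.ofReal_zero, mul_zero]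
  simp_rw [hkernel]
  exact exists_one_add_norm_pow_mul_norm_oscillatoryIntegral_le hφ
    (Complex.ofRealCLM.contDiff.comp (squaredAnnulusBump.contDiff.comp (contDiff_norm_sq ℝ)))
    hasCompactSupport_annulusBump N

theorem exists_norm_annulusKernel_le (hd : 1 ≤ d) {α : ℝ} (hα0 : 0 < α) (hα1 : α < 1) :
    ∃ C : ℝ, 0 ≤ C ∧ ∀ (t : ℝ) (w : Rd d),
      ‖annulusKernel α t w‖ ≤ C * (1 + ‖w‖) ^ (-((d : ℝ) / 2)) := by
  obtain ⟨C₀, hC₀, h₀⟩ := exists_one_add_norm_pow_mul_norm_annulusKernel_le d α 0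
  obtain ⟨C₁, h₁⟩ := exists_norm_oscillatoryIntegral_rpow_le hd hα0 hα1
    (g := fun ρ => (squaredAnnulusBump (ρ ^ 2) : ℂ)) (a := 1 / 2) (b := 3)
    (Complex.ofRealCLM.contDiff.comp (squaredAnnulusBump.contDiff.comp (contDiff_id.pow 2)))
    (by norm_num) (by norm_num) fun ρ hρ0 hρ => by
      refine Complex.ofReal_eq_zero.2 (squaredAnnulusBump_eq_zero fun h => hρ ⟨?_, ?_⟩)
      · nlinarith [h.1]
      · nlinarith [h.2]
  have hd0 : -((d : ℝ) / 2) ≤ 0 := neg_nonpos.2 (by positivity)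
  refine ⟨max C₀ C₁ * 2 ^ ((d : ℝ) / 2), by positivity, fun t w => ?_⟩
  have hdilate : 2 ^ ((d : ℝ) / 2) * (1 + ‖w‖) ^ (-((d : ℝ) / 2)) =
      ((1 + ‖w‖) / 2) ^ (-((d : ℝ) / 2)) := by
    rw [Real.div_rpow (by positivity) zero_le_two, Real.rpow_neg zero_le_two, div_inv_eq_mul,
      mul_comm]
  rw [mul_assoc, hdilate]
  rcases le_or_gt ‖w‖ 1 with hw | hw
  · calc ‖annulusKernel α t w‖ ≤ C₀ * 1 := by simpa using h₀ t w
      _ ≤ _ := by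
        gcongr
        · exact le_max_left _ _
        · exact Real.one_le_rpow_of_pos_of_le_one_of_nonpos (by positivity) (by linarith) hd0
  · calc ‖annulusKernel α t w‖ ≤ C₁ * ‖w‖ ^ (-((d : ℝ) / 2)) := h₁ t w hw.le
      _ ≤ _ := mul_le_mul (le_max_right _ _)
        (Real.rpow_le_rpow_of_nonpos (by positivity) (by linarith) hd0) (by positivity)
        (hC₀.trans (le_max_left _ _))

theorem le_rpow_mul_rpow_of_le_of_le {x A B θ : ℝ} (hx : 0 ≤ x) (hA : x ≤ A) (hB : x ≤ B)
    (hθ0 : 0 ≤ θ) (hθ1 : θ ≤ 1) : x ≤ A ^ (1 - θ) * B ^ θ :=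
  calc x = x ^ (1 - θ) * x ^ θ := by
        rw [← Real.rpow_add_of_nonneg hx (by linarith) hθ0, sub_add_cancel, Real.rpow_one]
    _ ≤ A ^ (1 - θ) * B ^ θ := mul_le_mul
        (Real.rpow_le_rpow hx hA (sub_nonneg.2 hθ1)) (Real.rpow_le_rpow hx hB hθ0)
        (Real.rpow_nonneg hx _) (Real.rpow_nonneg (hx.trans hA) _)

theorem exists_norm_annulusKernel_mul_le (hd : 1 ≤ d) {α : ℝ} (hα0 : 0 < α) (hα1 : α < 1)
    {p σ : ℝ} (hσ : 0 ≤ σ) (hp : p < d / 2 + σ) :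
    ∃ C : ℝ, 0 ≤ C ∧ ∀ (t : ℝ) (w : Rd d),
      ‖annulusKernel α t w‖ * (1 + ‖w‖) ^ p ≤ C * (1 + |t|) ^ σ := by
  -- Interpolating with weight `σ / N` costs exactly `(1 + |t|) ^ σ`, and the resulting decay
  -- exponent tends to `d / 2 + σ` as `N → ∞`.
  obtain ⟨N, hN⟩ := exists_nat_gt (max σ (σ * (d / 2) / (d / 2 + σ - p)))
  obtain ⟨hσN, hpN⟩ := max_lt_iff.1 hN
  have hN0 : 0 < (N : ℝ) := hσ.trans_lt hσN
  obtain ⟨C₁, hC₁, h₁⟩ := exists_norm_annulusKernel_le hd hα0 hα1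
  obtain ⟨C₂, hC₂, h₂⟩ := exists_one_add_norm_pow_mul_norm_annulusKernel_le d α N
  set θ : ℝ := σ / N with hθ
  have hθN : N * θ = σ := mul_div_cancel₀ _ hN0.ne'
  refine ⟨C₁ ^ (1 - θ) * C₂ ^ θ, by positivity, fun t w => ?_⟩
  set W : ℝ := 1 + ‖w‖
  have hW : 1 ≤ W := le_add_of_nonneg_right (norm_nonneg w)
  have hW0 : 0 < W := one_pos.trans_le hW
  have hexponent : p ≤ d / 2 * (1 - θ) + σ := by
    rw [div_lt_iff₀ (by linarith)] at hpN
    have : d / 2 * θ ≤ d / 2 + σ - p := by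
      rw [hθ, mul_div_assoc', div_le_iff₀ hN0]
      linarith
    linarith
  have hinterp := le_rpow_mul_rpow_of_le_of_le (norm_nonneg (annulusKernel α t w)) (h₁ t w)
    (B := C₂ * (1 + |t|) ^ N * (W ^ N)⁻¹) (by
      rw [← div_eq_mul_inv, le_div_iff₀' (by positivity)]
      exact h₂ t w) (div_nonneg hσ hN0.le) ((div_le_one hN0).2 hσN.le)
  calc ‖annulusKernel α t w‖ * W ^ p
      ≤ ((C₁ * W ^ (-((d : ℝ) / 2))) ^ (1 - θ) * (C₂ * (1 + |t|) ^ N * (W ^ N)⁻¹) ^ θ) *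
          W ^ (d / 2 * (1 - θ) + σ) := by gcongr
    _ = C₁ ^ (1 - θ) * C₂ ^ θ * (1 + |t|) ^ σ * (W ^ (-((d : ℝ) / 2) * (1 - θ)) * W ^ (-σ) *
          W ^ (d / 2 * (1 - θ) + σ)) := by
        rw [Real.mul_rpow hC₁ (by positivity), Real.mul_rpow (by positivity) (by positivity),
          Real.mul_rpow hC₂ (by positivity), ← Real.rpow_mul hW0.le, ← Real.rpow_natCast W,
          ← Real.rpow_natCast (1 + |t|), ← Real.rpow_mul (by positivity),
          ← Real.rpow_neg hW0.le, ← Real.rpow_mul hW0.le, neg_mul (N : ℝ), hθN]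
        ring
    _ = C₁ ^ (1 - θ) * C₂ ^ θ * (1 + |t|) ^ σ := by
        rw [← Real.rpow_add hW0, ← Real.rpow_add hW0]
        ring_nf
        simp

end AnnulusKernel

section GammaDimensional

variable {d : ℕ} {γ : ℝ} {μ : Measure (Rd d)}

theorem isBallBound_dimConst (h : IsGammaDimensional γ μ) : IsBallBound γ μ (dimConst γ μ) := by
  have hclosed : IsClosed {C : ℝ≥0 | IsBallBound γ μ C} := by
    simp only [IsBallBound, ofPred_forall]
    exact isClosed_iInter fun x => isClosed_iInter fun r => isClosed_iInter fun _ =>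
      isClosed_le continuous_const (ENNReal.continuous_ofReal.comp (by fun_prop))
  exact hclosed.csInf_mem h (OrderBot.bddBelow _)

theorem exists_lt_two_pow_and_one_add_rpow_neg_le {p r : ℝ} (hp : 0 ≤ p) (hr : 0 ≤ r) :
    ∃ k : ℕ, r < 2 ^ k ∧ (1 + r) ^ (-p) ≤ 2 ^ p * ((2 : ℝ) ^ k) ^ (-p) := by
  obtain ⟨n, hn, hn'⟩ := exists_nat_pow_near (le_add_of_nonneg_right hr) (one_lt_two (α := ℝ))
  refine ⟨n + 1, by linarith, ?_⟩
  calc (1 + r) ^ (-p) ≤ ((2 : ℝ) ^ n) ^ (-p) :=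
        Real.rpow_le_rpow_of_nonpos (by positivity) hn (neg_nonpos.2 hp)
    _ = 2 ^ p * ((2 : ℝ) ^ (n + 1)) ^ (-p) := by
        rw [pow_succ, Real.mul_rpow (by positivity) zero_le_two, mul_left_comm,
          ← Real.rpow_add two_pos, add_neg_cancel, Real.rpow_zero, mul_one]

theorem ofReal_one_add_mul_dist_rpow_neg_le_tsum {p R : ℝ} (hp : 0 ≤ p) (hR : 0 < R) (x y : Rd d) :
    ENNReal.ofReal ((1 + R * ‖x - y‖) ^ (-p)) ≤ ∑' k : ℕ, (ball x (2 ^ k / R)).indicator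
      (fun _ => ENNReal.ofReal (2 ^ p * ((2 : ℝ) ^ k) ^ (-p))) y := by
  obtain ⟨k, hk, hle⟩ := exists_lt_two_pow_and_one_add_rpow_neg_le hp
    (mul_nonneg hR.le (norm_nonneg (x - y)))
  have hmem : y ∈ ball x (2 ^ k / R) := by
    rwa [mem_ball', dist_eq_norm, lt_div_iff₀' hR]
  refine le_trans ?_ (ENNReal.le_tsum k)
  rw [indicator_of_mem hmem]
  exact ENNReal.ofReal_le_ofReal hle

/-- The sum `∑ k, 2 ^ p (2 ^ k) ^ (γ - p)` of the dyadic shells in the integral of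
`(1 + ‖x - y‖) ^ (-p)` against a `γ`-dimensional measure; meaningful for `γ < p`. -/
noncomputable def dyadicConst (γ p : ℝ) : ℝ := 2 ^ p * (1 - 2 ^ (γ - p))⁻¹

theorem two_rpow_sub_lt_one {p : ℝ} (hγp : γ < p) : (2 : ℝ) ^ (γ - p) < 1 :=
  Real.rpow_lt_one_of_one_lt_of_neg one_lt_two (sub_neg.2 hγp)

theorem dyadicConst_nonneg {p : ℝ} (hγp : γ < p) : 0 ≤ dyadicConst γ p :=
  mul_nonneg (by positivity) (inv_nonneg.2 (sub_nonneg.2 (two_rpow_sub_lt_one hγp).le))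

theorem IsBallBound.lintegral_one_add_rpow_le {C : ℝ≥0} (hμ : IsBallBound γ μ C) {p R : ℝ}
    (hp : 0 ≤ p) (hγp : γ < p) (hR : 0 < R) (x : Rd d) :
    ∫⁻ y, ENNReal.ofReal ((1 + R * ‖x - y‖) ^ (-p)) ∂μ ≤
      ENNReal.ofReal (dyadicConst γ p * (C * R ^ (-γ))) := by
  have hq1 := two_rpow_sub_lt_one hγp
  set q : ℝ := 2 ^ (γ - p) with hq
  have hshell (k : ℕ) : 2 ^ p * ((2 : ℝ) ^ k) ^ (-p) * (C * (2 ^ k / R) ^ γ) =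
      2 ^ p * (C * R ^ (-γ)) * q ^ k := by
    have hpow : ((2 : ℝ) ^ k) ^ (-p) * ((2 : ℝ) ^ k) ^ γ = q ^ k := by
      rw [← Real.rpow_add (by positivity), hq, ← Real.rpow_natCast, ← Real.rpow_natCast,
        ← Real.rpow_mul zero_le_two, ← Real.rpow_mul zero_le_two]
      ring_nf
    rw [Real.div_rpow (by positivity) hR.le, Real.rpow_neg hR.le, ← hpow]
    ring
  calc ∫⁻ y, ENNReal.ofReal ((1 + R * ‖x - y‖) ^ (-p)) ∂μ
      ≤ ∫⁻ y, ∑' k : ℕ, (ball x (2 ^ k / R)).indicator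
          (fun _ => ENNReal.ofReal (2 ^ p * ((2 : ℝ) ^ k) ^ (-p))) y ∂μ :=
        lintegral_mono (ofReal_one_add_mul_dist_rpow_neg_le_tsum hp hR x)
    _ = ∑' k : ℕ, ENNReal.ofReal (2 ^ p * ((2 : ℝ) ^ k) ^ (-p)) * μ (ball x (2 ^ k / R)) := by
        rw [lintegral_tsum fun k => (measurable_const.indicator measurableSet_ball).aemeasurable]
        simp_rw [lintegral_indicator_const measurableSet_ball]
    _ ≤ ∑' k : ℕ, ENNReal.ofReal (2 ^ p * (C * R ^ (-γ)) * q ^ k) := by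
        refine ENNReal.tsum_le_tsum fun k => ?_
        rw [← hshell, ENNReal.ofReal_mul (p := 2 ^ p * _) (by positivity)]
        exact mul_le_mul' le_rfl (hμ x (2 ^ k / R) (by positivity))
    _ = ENNReal.ofReal (∑' k : ℕ, 2 ^ p * (C * R ^ (-γ)) * q ^ k) :=
        (ENNReal.ofReal_tsum_of_nonneg (fun k => by positivity)
          ((summable_geometric_of_lt_one (by positivity) hq1).mul_left _)).symm
    _ = ENNReal.ofReal (dyadicConst γ p * (C * R ^ (-γ))) := by
        rw [tsum_mul_left, tsum_geometric_of_lt_one (by positivity) hq1, dyadicConst,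
          ← hq]
        ring_nf

end GammaDimensional

section SchurTest

variable {X : Type*} [MeasurableSpace X] {ν : Measure X} {A : ℝ≥0∞}

theorem two_mul_mul_le_sq_add_sq_ennreal (a b : ℝ≥0∞) : 2 * (a * b) ≤ a ^ 2 + b ^ 2 := by
  have := ENNReal.young_inequality a b Real.HolderConjugate.two_two
  simp only [ENNReal.rpow_ofNat, ENNReal.ofReal_ofNat] at this
  calc 2 * (a * b) ≤ 2 * (a ^ 2 / 2 + b ^ 2 / 2) := by gcongr
    _ = a ^ 2 + b ^ 2 := by
      rw [mul_add, ENNReal.mul_div_cancel two_ne_zero ENNReal.ofNat_ne_top,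
        ENNReal.mul_div_cancel two_ne_zero ENNReal.ofNat_ne_top]

theorem lintegral_lintegral_mul_le_of_symm_kernel [SFinite ν] {g : X → ℝ≥0∞} {k : X → X → ℝ≥0∞}
    (hg : Measurable g) (hk : Measurable (Function.uncurry k)) (hsymm : ∀ x y, k x y = k y x)
    (hA : ∀ x, ∫⁻ y, k x y ∂ν ≤ A) :
    ∫⁻ x, ∫⁻ y, g x * (g y * k x y) ∂ν ∂ν ≤ A * ∫⁻ x, g x ^ 2 ∂ν := by
  have hrow : ∫⁻ x, ∫⁻ y, g x ^ 2 * k x y ∂ν ∂ν ≤ A * ∫⁻ x, g x ^ 2 ∂ν := by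
    rw [← lintegral_const_mul _ (hg.pow_const 2)]
    refine lintegral_mono fun x => ?_
    rw [lintegral_const_mul _ hk.of_uncurry_left, mul_comm A]
    gcongr
    exact hA x
  have hcol : ∫⁻ x, ∫⁻ y, g y ^ 2 * k x y ∂ν ∂ν ≤ A * ∫⁻ x, g x ^ 2 ∂ν := by
    rw [lintegral_lintegral_swap (((hg.comp measurable_snd).pow_const 2).mul hk).aemeasurable]
    simpa only [hsymm] using hrow
  have hrow_meas : Measurable (Function.uncurry fun x y => g x ^ 2 * k x y) :=
    ((hg.comp measurable_fst).pow_const 2).mul hk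
  have hmeas : Measurable (Function.uncurry fun x y => g x * (g y * k x y)) :=
    (hg.comp measurable_fst).mul ((hg.comp measurable_snd).mul hk)
  refine (ENNReal.mul_le_mul_iff_right two_ne_zero ENNReal.ofNat_ne_top).1 ?_
  calc 2 * ∫⁻ x, ∫⁻ y, g x * (g y * k x y) ∂ν ∂ν
      = ∫⁻ x, ∫⁻ y, 2 * (g x * g y) * k x y ∂ν ∂ν := by
        rw [← lintegral_const_mul _ hmeas.lintegral_prod_right]
        simp_rw [← lintegral_const_mul 2 (hmeas.of_uncurry_left), mul_assoc]
    _ ≤ ∫⁻ x, ∫⁻ y, (g x ^ 2 * k x y + g y ^ 2 * k x y) ∂ν ∂ν :=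
        lintegral_mono fun x => lintegral_mono fun y => by
          rw [← add_mul]
          exact mul_le_mul_left (two_mul_mul_le_sq_add_sq_ennreal _ _) _
    _ = ∫⁻ x, ∫⁻ y, g x ^ 2 * k x y ∂ν ∂ν + ∫⁻ x, ∫⁻ y, g y ^ 2 * k x y ∂ν ∂ν := by
        rw [← lintegral_add_left hrow_meas.lintegral_prod_right]
        simp_rw [← lintegral_add_left hrow_meas.of_uncurry_left]
    _ ≤ 2 * (A * ∫⁻ x, g x ^ 2 ∂ν) := by
        rw [two_mul]
        exact add_le_add hrow hcol

variable {𝕜 H : Type*} [RCLike 𝕜] [NormedAddCommGroup H] [InnerProductSpace 𝕜 H] [CompleteSpace H]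
  [NormedSpace ℝ H] {e : X → H}

theorem enorm_integral_smul_sq_le_of_schur [SFinite ν] {g : X → 𝕜}
    (hg : StronglyMeasurable g) (he : StronglyMeasurable e)
    (hge : Integrable (fun x => g x • e x) ν)
    (hA : ∀ x, ∫⁻ y, ‖inner 𝕜 (e x) (e y)‖ₑ ∂ν ≤ A) :
    ‖∫ x, g x • e x ∂ν‖ₑ ^ 2 ≤ A * ∫⁻ x, ‖g x‖ₑ ^ 2 ∂ν := by
  set v := ∫ x, g x • e x ∂ν with hv
  have hpair (w : H) : ‖inner 𝕜 w v‖ₑ ≤ ∫⁻ y, ‖g y‖ₑ * ‖inner 𝕜 w (e y)‖ₑ ∂ν := by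
    rw [hv, ← integral_inner hge]
    simp_rw [← enorm_mul, ← inner_smul_right]
    exact enorm_integral_le_lintegral_enorm _
  calc ‖v‖ₑ ^ 2 = ‖inner 𝕜 v v‖ₑ := by
        rw [← ofReal_norm, ← ofReal_norm, inner_self_eq_norm_sq_to_K, norm_pow, RCLike.norm_ofReal,
          abs_norm, ENNReal.ofReal_pow (norm_nonneg v)]
    _ ≤ ∫⁻ x, ‖g x‖ₑ * ‖inner 𝕜 v (e x)‖ₑ ∂ν := hpair v
    _ ≤ ∫⁻ x, ∫⁻ y, ‖g x‖ₑ * (‖g y‖ₑ * ‖inner 𝕜 (e x) (e y)‖ₑ) ∂ν ∂ν :=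
        lintegral_mono fun x => by
          rw [lintegral_const_mul' _ _ enorm_ne_top, ← inner_conj_symm, RCLike.enorm_conj]
          exact mul_le_mul_right (hpair (e x)) _
    _ ≤ A * ∫⁻ x, ‖g x‖ₑ ^ 2 ∂ν :=
        lintegral_lintegral_mul_le_of_symm_kernel hg.enorm
          ((he.comp_measurable measurable_fst).inner (he.comp_measurable measurable_snd)).enorm
          (fun x y => by rw [← inner_conj_symm, RCLike.enorm_conj]) hA

theorem enorm_inner_integral_inner_smul (he2 : MemLp e 2 ν) (h : H) :
    ‖inner 𝕜 h (∫ x, inner 𝕜 (e x) h • e x ∂ν)‖ₑ = ∫⁻ x, ‖inner 𝕜 (e x) h‖ₑ ^ 2 ∂ν := by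
  have hg : MemLp (fun x => inner 𝕜 (e x) h) 2 ν := he2.inner_const h
  have hpair (x : X) : inner 𝕜 h (inner 𝕜 (e x) h • e x) = ((‖inner 𝕜 (e x) h‖ ^ 2 : ℝ) : 𝕜) := by
    rw [inner_smul_right, ← inner_conj_symm h, RCLike.mul_conj, RCLike.ofReal_pow]
  have hge : Integrable (fun x => inner 𝕜 (e x) h • e x) ν :=
    memLp_one_iff_integrable.1 (he2.smul hg)
  rw [← integral_inner hge]
  simp_rw [hpair]
  rw [integral_ofReal, ← ofReal_norm, RCLike.norm_ofReal,
    abs_of_nonneg (integral_nonneg fun x => sq_nonneg _),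
    ofReal_integral_eq_lintegral_ofReal (hg.integrable_norm_pow two_ne_zero)
      (Filter.Eventually.of_forall fun x => sq_nonneg _)]
  simp_rw [ENNReal.ofReal_pow (norm_nonneg _), ofReal_norm]

theorem lintegral_enorm_inner_sq_le_of_schur [SFinite ν] (he : StronglyMeasurable e)
    (he2 : MemLp e 2 ν) (hA : ∀ x, ∫⁻ y, ‖inner 𝕜 (e x) (e y)‖ₑ ∂ν ≤ A) (h : H) :
    ∫⁻ x, ‖inner 𝕜 (e x) h‖ₑ ^ 2 ∂ν ≤ A * ‖h‖ₑ ^ 2 := by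
  have hg : MemLp (fun x => inner 𝕜 (e x) h) 2 ν := he2.inner_const h
  set v := ∫ x, inner 𝕜 (e x) h • e x ∂ν
  set I := ∫⁻ x, ‖inner 𝕜 (e x) h‖ₑ ^ 2 ∂ν with hI
  have hv2 : ‖v‖ₑ ^ 2 ≤ A * I := enorm_integral_smul_sq_le_of_schur
    (he.inner stronglyMeasurable_const) he (memLp_one_iff_integrable.1 (he2.smul hg)) hA
  have hIv : I ≤ ‖h‖ₑ * ‖v‖ₑ := by
    rw [hI, ← enorm_inner_integral_inner_smul he2]
    exact (ENNReal.coe_le_coe.2 (nnnorm_inner_le_nnnorm h v)).trans_eq (ENNReal.coe_mul _ _)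
  rcases eq_or_ne I 0 with hI0 | hI0
  · simp [hI0]
  refine (ENNReal.mul_le_mul_iff_left hI0 ?_).1 ?_
  · exact (hIv.trans_lt (ENNReal.mul_lt_top enorm_lt_top enorm_lt_top)).ne
  calc I * I ≤ ‖h‖ₑ * ‖v‖ₑ * (‖h‖ₑ * ‖v‖ₑ) := mul_le_mul' hIv hIv
    _ = ‖h‖ₑ ^ 2 * ‖v‖ₑ ^ 2 := by ring
    _ ≤ ‖h‖ₑ ^ 2 * (A * I) := mul_le_mul_right hv2 _
    _ = A * ‖h‖ₑ ^ 2 * I := by ring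

end SchurTest

section WavePacket

theorem continuous_of_continuous_inner {Z 𝕜 H : Type*} [TopologicalSpace Z] [RCLike 𝕜]
    [NormedAddCommGroup H] [InnerProductSpace 𝕜 H] {e : Z → H}
    (h : Continuous fun z : Z × Z => inner 𝕜 (e z.1) (e z.2)) : Continuous e := by
  refine continuous_iff_continuousAt.2 fun z₀ => tendsto_iff_norm_sub_tendsto_zero.2 ?_
  have hnorm (z : Z) : ‖e z - e z₀‖ = √(RCLike.re (inner 𝕜 (e z) (e z) - inner 𝕜 (e z) (e z₀) -
      inner 𝕜 (e z₀) (e z) + inner 𝕜 (e z₀) (e z₀))) := by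
    rw [← inner_sub_sub_self, inner_self_eq_norm_sq, Real.sqrt_sq (norm_nonneg _)]
  simp_rw [hnorm]
  have hz₀ : Continuous fun z => √(RCLike.re (inner 𝕜 (e z) (e z) - inner 𝕜 (e z) (e z₀) -
      inner 𝕜 (e z₀) (e z) + inner 𝕜 (e z₀) (e z₀))) :=
    (RCLike.continuous_re.comp ((((h.comp (continuous_id.prodMk continuous_id)).sub
      (h.comp (continuous_id.prodMk continuous_const))).sub
      (h.comp (continuous_const.prodMk continuous_id))).add continuous_const)).sqrt
  simpa using hz₀.tendsto z₀

theorem continuous_oscillatoryIntegral {E : Type*} [NormedAddCommGroup E] [InnerProductSpace ℝ E]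
    [FiniteDimensional ℝ E] [MeasurableSpace E] [BorelSpace E] {φ : E → ℝ} {a : E → ℂ}
    (hφ : Measurable φ) (ha : Integrable a) :
    Continuous fun z : ℝ × E => oscillatoryIntegral φ a z.1 z.2 := by
  refine continuous_of_dominated (bound := fun ξ => ‖a ξ‖) (fun z => ?_)
    (fun z => Filter.Eventually.of_forall fun ξ => ?_) ha.norm
    (Filter.Eventually.of_forall fun ξ => by fun_prop)
  · exact AEStronglyMeasurable.mul (Measurable.aestronglyMeasurable (by fun_prop)) ha.1
  · rw [norm_mul, Complex.norm_exp_ofReal_mul_I, one_mul]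

variable {d : ℕ} {α R : ℝ}

/-- A smooth cutoff to the annulus `R ≤ |ξ| ≤ 2R`, where `ξ = 2πη`. -/
noncomputable def annulusCutoff (R : ℝ) (η : Rd d) : ℝ :=
  squaredAnnulusBump (‖(2 * Real.pi / R) • η‖ ^ 2)

theorem continuous_annulusCutoff : Continuous (annulusCutoff R : Rd d → ℝ) :=
  squaredAnnulusBump.continuous.comp (by fun_prop)

theorem hasCompactSupport_annulusCutoff : HasCompactSupport (annulusCutoff R : Rd d → ℝ) :=
  HasCompactSupport.intro (isCompact_closedBall 0 |R|) fun η hη => by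
    refine squaredAnnulusBump_eq_zero fun h => ?_
    rw [mem_closedBall_zero_iff, not_le] at hη
    rcases eq_or_ne R 0 with rfl | hR
    · norm_num at h
    have h3 : 3 < ‖(2 * Real.pi / R) • η‖ := by
      rw [norm_smul, Real.norm_eq_abs, abs_div, abs_of_pos Real.two_pi_pos, div_mul_eq_mul_div,
        lt_div_iff₀ (abs_pos.2 hR)]
      nlinarith [Real.pi_gt_three, abs_pos.2 hR]
    nlinarith [h.2]

theorem annulusCutoff_eq_one (hR : 0 < R) {η : Rd d}
    (hη : R ≤ 2 * Real.pi * ‖η‖ ∧ 2 * Real.pi * ‖η‖ ≤ 2 * R) : annulusCutoff R η = 1 := by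
  have hnorm : ‖(2 * Real.pi / R) • η‖ = 2 * Real.pi * ‖η‖ / R := by
    rw [norm_smul, Real.norm_of_nonneg (by positivity), div_mul_eq_mul_div]
  have h1 : 1 ≤ 2 * Real.pi * ‖η‖ / R := (one_le_div hR).2 hη.1
  have h2 : 2 * Real.pi * ‖η‖ / R ≤ 2 := (div_le_iff₀ hR).2 hη.2
  refine squaredAnnulusBump_eq_one ?_ ?_ <;> rw [hnorm] <;> nlinarith

theorem memLp_wavePacket (α R t : ℝ) (x : Rd d) :
    MemLp (fun η : Rd d => Complex.exp ((-(2 * Real.pi * inner ℝ x η +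
      t * (2 * Real.pi * ‖η‖) ^ α) : ℝ) * Complex.I) * (√(annulusCutoff R η) : ℂ)) 2 volume := by
  have hcutoff : MemLp (fun η : Rd d => √(annulusCutoff R η)) 2 volume :=
    continuous_annulusCutoff.sqrt.memLp_of_hasCompactSupport
      (hasCompactSupport_annulusCutoff.comp_left Real.sqrt_zero)
  refine hcutoff.congr_norm (Measurable.aestronglyMeasurable ?_)
    (Filter.Eventually.of_forall fun η => ?_)
  · have := (continuous_annulusCutoff (d := d) (R := R)).measurable
    fun_prop
  · rw [norm_mul, Complex.norm_exp_ofReal_mul_I, one_mul, Complex.norm_real]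

/-- The vector of `L²` whose pairing with `𝓕 f` is `exp (i t (-Δ) ^ (α / 2)) f (x)` when `𝓕 f` lives
on the annulus `R ≤ |ξ| ≤ 2R`: a conjugate plane wave, cut off to that annulus. The square root of
the cutoff makes the Gram matrix of these vectors an `annulusKernel`. -/
noncomputable def wavePacket (α R t : ℝ) (x : Rd d) : Lp ℂ 2 (volume : Measure (Rd d)) :=
  (memLp_wavePacket α R t x).toLp

theorem fracSchrodinger_eq_inner_wavePacket (hR : 0 < R) {f : Lp ℂ 2 (volume : Measure (Rd d))}
    (hf : FourierSupportedInAnnulus R f) (α t : ℝ) (x : Rd d) :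
    fracSchrodinger α t f x = inner ℂ (wavePacket α R t x) (𝓕 f) := by
  rw [fracSchrodinger, Real.fourierInv_eq', L2.inner_def]
  refine integral_congr_ae ?_
  filter_upwards [hf, (memLp_wavePacket α R t x).coeFn_toLp] with η hη hpacket
  rw [wavePacket, hpacket, RCLike.inner_apply]
  by_cases hmem : R ≤ 2 * Real.pi * ‖η‖ ∧ 2 * Real.pi * ‖η‖ ≤ 2 * R
  · rw [annulusCutoff_eq_one hR hmem, Real.sqrt_one, Complex.ofReal_one, mul_one,
      ← Complex.exp_conj, smul_eq_mul, ← mul_assoc, ← Complex.exp_add, mul_comm, real_inner_comm]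
    congr 2
    simp only [map_mul, Complex.conj_ofReal, Complex.conj_I]
    push_cast
    ring
  · simp only [hη hmem, mul_zero, zero_mul, smul_zero]

theorem inner_wavePacket_wavePacket (hR : 0 < R) (α t t' : ℝ) (x y : Rd d) :
    inner ℂ (wavePacket α R t x) (wavePacket α R t' y) =
      ((R / (2 * Real.pi)) ^ d : ℝ) * annulusKernel α ((t - t') * R ^ α) (R • (x - y)) := by
  have hc : 0 < 2 * Real.pi / R := div_pos Real.two_pi_pos hR
  have hdilate := Measure.integral_comp_smul (volume : Measure (Rd d)) (fun ξ : Rd d =>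
    Complex.exp ((inner ℝ (R • (x - y)) ξ + (t - t') * R ^ α * ‖ξ‖ ^ α : ℝ) * Complex.I) *
      (squaredAnnulusBump (‖ξ‖ ^ 2) : ℂ)) (2 * Real.pi / R)
  rw [finrank_euclideanSpace_fin, abs_of_pos (by positivity), Complex.real_smul, ← inv_pow,
    inv_div] at hdilate
  rw [annulusKernel, oscillatoryIntegral, ← hdilate, L2.inner_def]
  refine integral_congr_ae ?_
  filter_upwards [(memLp_wavePacket α R t x).coeFn_toLp,
    (memLp_wavePacket α R t' y).coeFn_toLp] with η hη hη'
  have hscale : R ^ α * (2 * Real.pi / R * ‖η‖) ^ α = (2 * Real.pi * ‖η‖) ^ α := by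
    rw [← Real.mul_rpow hR.le (by positivity)]
    congr 1
    field_simp
  have hsq : (√(annulusCutoff R η) : ℂ) * √(annulusCutoff R η) = annulusCutoff R η := by
    rw [← Complex.ofReal_mul, Real.mul_self_sqrt (x := annulusCutoff R η) squaredAnnulusBump.nonneg]
  have hinner : inner ℝ (R • (x - y)) ((2 * Real.pi / R) • η) =
      2 * Real.pi * inner ℝ x η - 2 * Real.pi * inner ℝ y η := by
    rw [real_inner_smul_left, real_inner_smul_right, inner_sub_left]
    field_simp
  rw [wavePacket, wavePacket, hη, hη', RCLike.inner_apply, map_mul, ← Complex.exp_conj,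
    Complex.conj_ofReal, mul_mul_mul_comm, hsq, ← Complex.exp_add, annulusCutoff, hinner,
    norm_smul, Real.norm_of_nonneg hc.le, mul_assoc (t - t'), hscale]
  congr 2
  simp only [map_mul, Complex.conj_ofReal, Complex.conj_I]
  push_cast
  ring

theorem continuous_wavePacket (hR : 0 < R) (α : ℝ) :
    Continuous fun z : ℝ × Rd d => wavePacket α R z.1 z.2 := by
  have hbump : Integrable fun ξ : Rd d => (squaredAnnulusBump (‖ξ‖ ^ 2) : ℂ) :=
    Continuous.integrable_of_hasCompactSupport
      (Complex.continuous_ofReal.comp (squaredAnnulusBump.continuous.comp (by fun_prop)))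
      hasCompactSupport_annulusBump
  have hkernel : Continuous fun z : ℝ × Rd d => annulusKernel α z.1 z.2 :=
    continuous_oscillatoryIntegral (by fun_prop) hbump
  refine continuous_of_continuous_inner (𝕜 := ℂ) ?_
  simp_rw [inner_wavePacket_wavePacket hR]
  exact continuous_const.mul (hkernel.comp
    (f := fun z : (ℝ × Rd d) × (ℝ × Rd d) => ((z.1.1 - z.2.1) * R ^ α, R • (z.1.2 - z.2.2)))
    (by fun_prop))

theorem FourierSupportedInAnnulus.continuous_fracSchrodinger (hR : 0 < R)
    {f : Lp ℂ 2 (volume : Measure (Rd d))} (hf : FourierSupportedInAnnulus R f) (α : ℝ) :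
    Continuous fun z : ℝ × Rd d => fracSchrodinger α z.1 f z.2 := by
  simp_rw [fracSchrodinger_eq_inner_wavePacket hR hf]
  exact (continuous_wavePacket hR α).inner continuous_const

end WavePacket

section MeasurableSelection

variable {X T : Type*} [MeasurableSpace X] [MeasurableSpace T] {F : T → X → ℝ≥0∞}

theorem exists_measurable_apply_eq_partialSups (hF : Measurable (Function.uncurry F)) (q : ℕ → T)
    (n : ℕ) : ∃ τ : X → T, Measurable τ ∧ ∀ x, F (τ x) x = partialSups (fun k => F (q k) x) n := by
  induction n with
  | zero => exact ⟨fun _ => q 0, measurable_const, fun x => by rw [partialSups_zero]⟩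
  | succ n ih =>
    obtain ⟨τ, hτ, hFτ⟩ := ih
    classical
    refine ⟨fun x => if F (τ x) x ≤ F (q (n + 1)) x then q (n + 1) else τ x,
      Measurable.ite (measurableSet_le ?_ ?_) measurable_const hτ, fun x => ?_⟩
    · exact hF.comp (hτ.prodMk measurable_id)
    · exact hF.comp (measurable_const.prodMk measurable_id)
    · beta_reduce
      rw [partialSups_add_one, ← hFτ]
      split_ifs with h
      · exact (sup_of_le_right h).symm
      · exact (sup_of_le_left (not_le.1 h).le).symm

theorem lintegral_iSup_le_of_forall_measurable [TopologicalSpace T]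
    [TopologicalSpace.SeparableSpace T] [Nonempty T] {ν : Measure X} {K : ℝ≥0∞}
    (hF : Measurable (Function.uncurry F)) (hFc : ∀ x, Continuous fun t => F t x)
    (hK : ∀ τ : X → T, Measurable τ → ∫⁻ x, F (τ x) x ∂ν ≤ K) :
    ∫⁻ x, ⨆ t, F t x ∂ν ≤ K := by
  set q := TopologicalSpace.denseSeq T with hq
  have hsup (x : X) : ⨆ t, F t x = ⨆ n, partialSups (fun k => F (q k) x) n := by
    rw [iSup_partialSups_eq, ← (TopologicalSpace.denseRange_denseSeq T).ciSup' (hFc x), hq,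
      iSup_range' (fun t => F t x)]
  have hmeas (n : ℕ) : Measurable fun x => partialSups (fun k => F (q k) x) n := by
    obtain ⟨τ, hτ, hFτ⟩ := exists_measurable_apply_eq_partialSups hF q n
    simp_rw [← hFτ]
    exact hF.comp (hτ.prodMk measurable_id)
  simp_rw [hsup]
  rw [lintegral_iSup hmeas fun m n hmn x => (partialSups fun k => F (q k) x).monotone hmn]
  refine iSup_le fun n => ?_
  obtain ⟨τ, hτ, hFτ⟩ := exists_measurable_apply_eq_partialSups hF q n
  simp_rw [← hFτ]
  exact hK τ hτ

end MeasurableSelection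

section Partition

theorem exists_mem_Ioc_div_of_mem_Ioc {n : ℕ} (hn : 0 < n) {t : ℝ} (ht : t ∈ Ioc (0 : ℝ) 1) :
    ∃ j < n, t ∈ Ioc ((j : ℝ) / n) ((j + 1) / n) := by
  have hn' : (0 : ℝ) < n := Nat.cast_pos.2 hn
  obtain ⟨j, hj⟩ := Nat.exists_eq_add_one.2 (Nat.ceil_pos.2 (mul_pos ht.1 hn'))
  have hceil : (j : ℝ) < t * n ∧ t * n ≤ j + 1 := by
    have hlt := Nat.ceil_lt_add_one (mul_pos ht.1 hn').le
    have hle := Nat.le_ceil (t * n)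
    rw [hj] at hlt hle
    push_cast at hlt hle
    exact ⟨by linarith, hle⟩
  refine ⟨j, ?_, (div_lt_iff₀ hn').2 hceil.1, (le_div_iff₀ hn').2 hceil.2⟩
  exact_mod_cast hceil.1.trans_le (mul_le_of_le_one_left hn'.le ht.2)

theorem iSup_Ioc_zero_one_le_sum {n : ℕ} (hn : 0 < n) (F : ℝ → ℝ≥0∞) :
    ⨆ t ∈ Ioc (0 : ℝ) 1, F t ≤
      ∑ j ∈ Finset.range n, ⨆ t ∈ Ioc ((j : ℝ) / n) ((j + 1) / n), F t := by
  refine iSup₂_le fun t ht => ?_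
  obtain ⟨j, hj, htj⟩ := exists_mem_Ioc_div_of_mem_Ioc hn ht
  calc F t ≤ ⨆ t ∈ Ioc ((j : ℝ) / n) ((j + 1) / n), F t := le_iSup₂ (f := fun t _ => F t) t htj
    _ ≤ _ := Finset.single_le_sum
      (f := fun j : ℕ => ⨆ t ∈ Ioc ((j : ℝ) / n) ((j + 1) / n), F t)
      (fun _ _ => zero_le) (Finset.mem_range.2 hj)

end Partition

section MaximalEstimate

variable {d : ℕ} {α γ R : ℝ} {μ : Measure (Rd d)}

theorem IsBallBound.isFiniteMeasure_restrict_ball {C : ℝ≥0} (hμ : IsBallBound γ μ C) (x : Rd d)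
    {r : ℝ} (hr : 0 < r) : IsFiniteMeasure (μ.restrict (ball x r)) :=
  isFiniteMeasure_restrict.2 ((hμ x r hr).trans_lt ENNReal.ofReal_lt_top).ne

theorem norm_wavePacket (hR : 0 < R) (α t : ℝ) (x : Rd d) :
    ‖wavePacket α R t x‖ = ‖wavePacket α R 0 (0 : Rd d)‖ := by
  simp_rw [@norm_eq_sqrt_re_inner ℂ, inner_wavePacket_wavePacket hR, sub_self]

theorem stronglyMeasurable_wavePacket (hR : 0 < R) (α : ℝ) :
    StronglyMeasurable fun z : ℝ × Rd d => wavePacket α R z.1 z.2 :=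
  (continuous_wavePacket hR α).stronglyMeasurable

theorem norm_inner_wavePacket_le (hR : 0 < R) {p T B : ℝ}
    (hB : ∀ (t : ℝ) (w : Rd d), |t| ≤ T → ‖annulusKernel α t w‖ * (1 + ‖w‖) ^ p ≤ B)
    {t t' : ℝ} (ht : |t - t'| * R ^ α ≤ T) (x y : Rd d) :
    ‖inner ℂ (wavePacket α R t x) (wavePacket α R t' y)‖ ≤
      R ^ d * B * (1 + R * ‖x - y‖) ^ (-p) := by
  have hkernel := hB ((t - t') * R ^ α) (R • (x - y))
    (by rwa [abs_mul, abs_of_pos (Real.rpow_pos_of_pos hR α)])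
  rw [norm_smul, Real.norm_of_nonneg hR.le, ← le_div_iff₀ (by positivity), div_eq_mul_inv,
    ← Real.rpow_neg (by positivity)] at hkernel
  have hscale : R / (2 * Real.pi) ≤ R :=
    div_le_self hR.le (by linarith [Real.pi_gt_three])
  rw [inner_wavePacket_wavePacket hR, norm_mul, Complex.norm_real,
    Real.norm_of_nonneg (by positivity), mul_assoc]
  gcongr

theorem IsBallBound.lintegral_enorm_inner_wavePacket_le {C : ℝ≥0} (hμ : IsBallBound γ μ C)
    (hR : 0 < R) {p T B : ℝ} (hp : 0 ≤ p) (hγp : γ < p) (hB0 : 0 ≤ B)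
    (hB : ∀ (t : ℝ) (w : Rd d), |t| ≤ T → ‖annulusKernel α t w‖ * (1 + ‖w‖) ^ p ≤ B)
    {τ : Rd d → ℝ} (hτ : ∀ x y, |τ x - τ y| * R ^ α ≤ T) (x : Rd d) :
    ∫⁻ y, ‖inner ℂ (wavePacket α R (τ x) x) (wavePacket α R (τ y) y)‖ₑ ∂μ ≤
      ENNReal.ofReal (R ^ d * B * (dyadicConst γ p * (C * R ^ (-γ)))) := by
  have hRB : 0 ≤ R ^ d * B := by positivity
  calc ∫⁻ y, ‖inner ℂ (wavePacket α R (τ x) x) (wavePacket α R (τ y) y)‖ₑ ∂μ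
      ≤ ∫⁻ y, ENNReal.ofReal (R ^ d * B) * ENNReal.ofReal ((1 + R * ‖x - y‖) ^ (-p)) ∂μ := by
        refine lintegral_mono fun y => ?_
        rw [← ofReal_norm, ← ENNReal.ofReal_mul hRB]
        exact ENNReal.ofReal_le_ofReal (norm_inner_wavePacket_le hR hB (hτ x y) x y)
    _ = ENNReal.ofReal (R ^ d * B) * ∫⁻ y, ENNReal.ofReal ((1 + R * ‖x - y‖) ^ (-p)) ∂μ :=
        lintegral_const_mul' _ _ ENNReal.ofReal_ne_top
    _ ≤ ENNReal.ofReal (R ^ d * B * (dyadicConst γ p * (C * R ^ (-γ)))) := by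
        rw [ENNReal.ofReal_mul hRB]
        gcongr
        exact hμ.lintegral_one_add_rpow_le hp hγp hR x

theorem IsBallBound.lintegral_fracSchrodinger_comp_sq_le {C : ℝ≥0} (hμ : IsBallBound γ μ C)
    (hR : 0 < R) {p T B : ℝ} (hp : 0 ≤ p) (hγp : γ < p) (hB0 : 0 ≤ B)
    (hB : ∀ (t : ℝ) (w : Rd d), |t| ≤ T → ‖annulusKernel α t w‖ * (1 + ‖w‖) ^ p ≤ B)
    {f : Lp ℂ 2 (volume : Measure (Rd d))} (hf : FourierSupportedInAnnulus R f)
    {τ : Rd d → ℝ} (hτm : Measurable τ) (hτ : ∀ x y, |τ x - τ y| * R ^ α ≤ T) :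
    ∫⁻ x in ball 0 1, ‖fracSchrodinger α (τ x) f x‖ₑ ^ 2 ∂μ ≤
      ENNReal.ofReal (R ^ d * B * (dyadicConst γ p * (C * R ^ (-γ)))) * ‖f‖ₑ ^ 2 := by
  have := hμ.isFiniteMeasure_restrict_ball 0 one_pos
  have hmeas : StronglyMeasurable fun x => wavePacket α R (τ x) x :=
    (stronglyMeasurable_wavePacket hR α).comp_measurable (g := fun x => (τ x, x))
      (hτm.prodMk measurable_id)
  have hLp : MemLp (fun x => wavePacket α R (τ x) x) 2 (μ.restrict (ball 0 1)) :=
    MemLp.of_bound hmeas.aestronglyMeasurable _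
      (Filter.Eventually.of_forall fun x => (norm_wavePacket hR α (τ x) x).le)
  have hfourier : ‖𝓕 f‖ₑ = ‖f‖ₑ := by rw [← ofReal_norm, Lp.norm_fourier_eq, ofReal_norm]
  simp_rw [fracSchrodinger_eq_inner_wavePacket hR hf, ← hfourier]
  refine lintegral_enorm_inner_sq_le_of_schur hmeas hLp (fun x => ?_) _
  exact (lintegral_mono' Measure.restrict_le_self le_rfl).trans
    (hμ.lintegral_enorm_inner_wavePacket_le hR hp hγp hB0 hB hτ x)

theorem IsBallBound.lintegral_iSup_fracSchrodinger_sq_le {C : ℝ≥0} (hμ : IsBallBound γ μ C)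
    (hR : 0 < R) {p T B : ℝ} (hp : 0 ≤ p) (hγp : γ < p) (hB0 : 0 ≤ B)
    (hB : ∀ (t : ℝ) (w : Rd d), |t| ≤ T → ‖annulusKernel α t w‖ * (1 + ‖w‖) ^ p ≤ B)
    {f : Lp ℂ 2 (volume : Measure (Rd d))} (hf : FourierSupportedInAnnulus R f)
    {I : Set ℝ} (hI : I.Nonempty) (hIT : ∀ t ∈ I, ∀ t' ∈ I, |t - t'| * R ^ α ≤ T) :
    ∫⁻ x in ball 0 1, ⨆ t ∈ I, ‖fracSchrodinger α t f x‖ₑ ^ 2 ∂μ ≤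
      ENNReal.ofReal (R ^ d * B * (dyadicConst γ p * (C * R ^ (-γ)))) * ‖f‖ₑ ^ 2 := by
  have := hI.to_subtype
  have hcont : Continuous fun z : I × Rd d => fracSchrodinger α z.1 f z.2 :=
    (hf.continuous_fracSchrodinger hR α).comp (f := fun z : I × Rd d => ((z.1 : ℝ), z.2))
      (by fun_prop)
  have hF : Continuous fun z : I × Rd d => ‖fracSchrodinger α z.1 f z.2‖ₑ ^ 2 :=
    (ENNReal.continuous_pow 2).comp hcont.enorm
  simp_rw [iSup_subtype']
  refine lintegral_iSup_le_of_forall_measurable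
    (F := fun (t : I) x => ‖fracSchrodinger α t f x‖ₑ ^ 2) hF.measurable
    (fun x => hF.comp (f := fun t : I => (t, x)) (by fun_prop)) fun τ hτ => ?_
  exact hμ.lintegral_fracSchrodinger_comp_sq_le hR hp hγp hB0 hB hf
    (measurable_subtype_coe.comp hτ) fun x y => hIT _ (τ x).2 _ (τ y).2

theorem measurable_biSup_of_continuous {X T : Type*} [TopologicalSpace X] [MeasurableSpace X]
    [OpensMeasurableSpace X] {F : T → X → ℝ≥0∞} (hF : ∀ t, Continuous (F t)) (I : Set T) :
    Measurable fun x => ⨆ t ∈ I, F t x :=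
  (lowerSemicontinuous_biSup fun t _ => (hF t).lowerSemicontinuous).measurable

theorem maximalFunction_sq_le_sum {n : ℕ} (hn : 0 < n) (f : Lp ℂ 2 (volume : Measure (Rd d)))
    (x : Rd d) : maximalFunction α f x ^ 2 ≤ ∑ j ∈ Finset.range n,
      ⨆ t ∈ Ioc ((j : ℝ) / n) ((j + 1) / n), ‖fracSchrodinger α t f x‖ₑ ^ 2 := by
  rw [maximalFunction, ENNReal.iSup₂_pow_of_ne_zero _ two_ne_zero]
  exact iSup_Ioc_zero_one_le_sum hn _

theorem abs_sub_le_of_mem_Ioc_div {n j : ℕ} {t t' : ℝ}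
    (ht : t ∈ Ioc ((j : ℝ) / n) ((j + 1) / n)) (ht' : t' ∈ Ioc ((j : ℝ) / n) ((j + 1) / n)) :
    |t - t'| ≤ 1 / n := by
  have hlen : ((j : ℝ) + 1) / n - j / n = 1 / n := by ring
  rw [abs_le]
  constructor <;> linarith [ht.1, ht.2, ht'.1, ht'.2]

theorem exists_lintegral_maximalFunction_sq_le (hd : 1 ≤ d) (hα0 : 0 < α) (hα1 : α < 1) {σ : ℝ}
    (hγ : 0 ≤ γ) (hσ : 0 ≤ σ) (hγσ : γ < d / 2 + σ) :
    ∃ K : ℝ, 0 ≤ K ∧ ∀ μ : Measure (Rd d), IsGammaDimensional γ μ → ∀ R : ℝ, 0 < R →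
      ∀ f : Lp ℂ 2 (volume : Measure (Rd d)), FourierSupportedInAnnulus R f → ∀ n : ℕ, 0 < n →
        ∫⁻ x in ball 0 1, maximalFunction α f x ^ 2 ∂μ ≤ ENNReal.ofReal
          (K * (n * (1 + R ^ α / n) ^ σ) * R ^ (d - γ) * dimConst γ μ) * ‖f‖ₑ ^ 2 := by
  obtain ⟨p, hγp, hp⟩ := exists_between hγσ
  obtain ⟨B, hB0, hB⟩ := exists_norm_annulusKernel_mul_le hd hα0 hα1 hσ hp
  refine ⟨B * dyadicConst γ p, mul_nonneg hB0 (dyadicConst_nonneg hγp),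
    fun μ hμ R hR f hf n hn => ?_⟩
  set T := R ^ α / n
  have hn' : (0 : ℝ) < n := Nat.cast_pos.2 hn
  have hkernel (t : ℝ) (w : Rd d) (ht : |t| ≤ T) :
      ‖annulusKernel α t w‖ * (1 + ‖w‖) ^ p ≤ B * (1 + T) ^ σ :=
    (hB t w).trans (by gcongr)
  have hpiece (j : ℕ) : ∫⁻ x in ball 0 1, ⨆ t ∈ Ioc ((j : ℝ) / n) ((j + 1) / n),
      ‖fracSchrodinger α t f x‖ₑ ^ 2 ∂μ ≤ ENNReal.ofReal
        (R ^ d * (B * (1 + T) ^ σ) * (dyadicConst γ p * (dimConst γ μ * R ^ (-γ)))) * ‖f‖ₑ ^ 2 := by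
    refine (isBallBound_dimConst hμ).lintegral_iSup_fracSchrodinger_sq_le hR (hγ.trans hγp.le) hγp
      (by positivity) hkernel hf (nonempty_Ioc.2 (by gcongr; linarith)) fun t ht t' ht' => ?_
    calc |t - t'| * R ^ α ≤ 1 / n * R ^ α := by
          gcongr
          exact abs_sub_le_of_mem_Ioc_div ht ht'
      _ = T := one_div_mul_eq_div _ _
  have hmeas (j : ℕ) : Measurable fun x => ⨆ t ∈ Ioc ((j : ℝ) / n) ((j + 1) / n),
      ‖fracSchrodinger α t f x‖ₑ ^ 2 :=
    measurable_biSup_of_continuous (fun t => (ENNReal.continuous_pow 2).comp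
      ((hf.continuous_fracSchrodinger hR α).along_snd (x := t)).enorm) _
  calc ∫⁻ x in ball 0 1, maximalFunction α f x ^ 2 ∂μ
      ≤ ∫⁻ x in ball 0 1, ∑ j ∈ Finset.range n, ⨆ t ∈ Ioc ((j : ℝ) / n) ((j + 1) / n),
          ‖fracSchrodinger α t f x‖ₑ ^ 2 ∂μ := lintegral_mono (maximalFunction_sq_le_sum hn f)
    _ ≤ ∑ _j ∈ Finset.range n, ENNReal.ofReal (R ^ d * (B * (1 + T) ^ σ) *
          (dyadicConst γ p * (dimConst γ μ * R ^ (-γ)))) * ‖f‖ₑ ^ 2 := by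
        rw [lintegral_finsetSum _ fun j _ => hmeas j]
        exact Finset.sum_le_sum fun j _ => hpiece j
    _ = _ := by
        rw [Finset.sum_const, Finset.card_range, nsmul_eq_mul, ← mul_assoc,
          ← ENNReal.ofReal_natCast, ← ENNReal.ofReal_mul hn'.le, sub_eq_add_neg, Real.rpow_add hR,
          Real.rpow_natCast]
        ring_nf

theorem exists_forall_exists_nat_mul_one_add_rpow_le {D s : ℝ} (hD : 0 < D) (hα0 : 0 < α)
    (hγ : 0 ≤ γ) (hs : min (max 0 (α * (γ / 2 - D / 4))) (α / 2) < s) :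
    ∃ σ K : ℝ, 0 ≤ σ ∧ γ < D / 2 + σ ∧ 0 ≤ K ∧ ∀ R : ℝ, 1 ≤ R →
      ∃ n : ℕ, 0 < n ∧ n * (1 + R ^ α / n) ^ σ ≤ K * R ^ (2 * s) := by
  -- In the first case `(0, 1]` is kept whole; in the second it is cut into about `R ^ α` pieces,
  -- each of bounded length after rescaling.
  rcases min_lt_iff.1 hs with hs | hs
  · obtain ⟨hs0, hsγ⟩ := max_lt_iff.1 hs
    refine ⟨2 * s / α, 2 ^ (2 * s / α), by positivity, ?_, by positivity, fun R hR =>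
      ⟨1, one_pos, ?_⟩⟩
    · rw [← sub_lt_iff_lt_add', lt_div_iff₀ hα0]
      linarith
    · have hRα : 1 ≤ R ^ α := Real.one_le_rpow hR hα0.le
      calc ((1 : ℕ) : ℝ) * (1 + R ^ α / (1 : ℕ)) ^ (2 * s / α) ≤ (2 * R ^ α) ^ (2 * s / α) := by
            rw [Nat.cast_one, one_mul, div_one]
            gcongr
            linarith
        _ = 2 ^ (2 * s / α) * R ^ (2 * s) := by
            rw [Real.mul_rpow zero_le_two (by positivity), ← Real.rpow_mul (by positivity),
              mul_div_cancel₀ _ hα0.ne']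
  · refine ⟨γ, 2 * 2 ^ γ, hγ, by linarith, by positivity, fun R hR => ?_⟩
    have hRα : 1 ≤ R ^ α := Real.one_le_rpow hR hα0.le
    have hn : 0 < ⌈R ^ α⌉₊ := Nat.ceil_pos.2 (by positivity)
    refine ⟨⌈R ^ α⌉₊, hn, ?_⟩
    have hn_le : (⌈R ^ α⌉₊ : ℝ) ≤ 2 * R ^ (2 * s) := by
      calc (⌈R ^ α⌉₊ : ℝ) ≤ 2 * R ^ α := by
            linarith [Nat.ceil_lt_add_one (a := R ^ α) (by positivity)]
        _ ≤ 2 * R ^ (2 * s) := by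
            gcongr
            linarith
    have hT : R ^ α / ⌈R ^ α⌉₊ ≤ 1 := (div_le_one (Nat.cast_pos.2 hn)).2 (Nat.le_ceil _)
    calc (⌈R ^ α⌉₊ : ℝ) * (1 + R ^ α / ⌈R ^ α⌉₊) ^ γ ≤ 2 * R ^ (2 * s) * 2 ^ γ := by
          gcongr
          linarith
      _ = 2 * 2 ^ γ * R ^ (2 * s) := by ring

theorem exists_lintegral_maximalFunction_sq_le_rpow (hd : 1 ≤ d) (hα0 : 0 < α) (hα1 : α < 1)
    {s : ℝ} (hγ : 0 ≤ γ) (hs : min (max 0 (α * (γ / 2 - (d : ℝ) / 4))) (α / 2) < s) :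
    ∃ C : ℝ, 0 < C ∧ ∀ μ : Measure (Rd d), IsGammaDimensional γ μ → ∀ R : ℝ, 1 ≤ R →
      ∀ f : Lp ℂ 2 (volume : Measure (Rd d)), FourierSupportedInAnnulus R f →
        ∫⁻ x in ball 0 1, maximalFunction α f x ^ 2 ∂μ ≤ ENNReal.ofReal
          (C * (R ^ (((d : ℝ) - γ) / 2 + s)) ^ 2 * dimConst γ μ) * ‖f‖ₑ ^ 2 := by
  obtain ⟨σ, K, hσ, hγσ, hK, hpieces⟩ := exists_forall_exists_nat_mul_one_add_rpow_le
    (Nat.cast_pos.2 hd) hα0 hγ hs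
  obtain ⟨A, hA, hmaximal⟩ := exists_lintegral_maximalFunction_sq_le hd hα0 hα1 hγ hσ hγσ
  refine ⟨A * K + 1, by positivity, fun μ hμ R hR f hf => ?_⟩
  obtain ⟨n, hn, hle⟩ := hpieces R hR
  have hR0 : 0 < R := one_pos.trans_le hR
  have hpow : (R ^ (((d : ℝ) - γ) / 2 + s)) ^ 2 = R ^ (2 * s) * R ^ (d - γ) := by
    rw [← Real.rpow_mul_natCast hR0.le, ← Real.rpow_add hR0]
    congr 1
    push_cast
    ring
  refine (hmaximal μ hμ R hR0 f hf n hn).trans ?_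
  gcongr ENNReal.ofReal (?_ * _) * _
  calc A * (n * (1 + R ^ α / n) ^ σ) * R ^ (d - γ)
      ≤ A * (K * R ^ (2 * s)) * R ^ (d - γ) := by gcongr
    _ = A * K * (R ^ (((d : ℝ) - γ) / 2 + s)) ^ 2 := by rw [hpow]; ring
    _ ≤ (A * K + 1) * (R ^ (((d : ℝ) - γ) / 2 + s)) ^ 2 := by
        gcongr
        exact le_add_of_nonneg_right zero_le_one

theorem eLpNorm_two_le_ofReal_of_lintegral_sq_le {X : Type*} [MeasurableSpace X] {ν : Measure X}
    {F : X → ℝ≥0∞} {A : ℝ} (hA : 0 ≤ A) (h : ∫⁻ x, F x ^ 2 ∂ν ≤ ENNReal.ofReal (A ^ 2)) :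
    eLpNorm F 2 ν ≤ ENNReal.ofReal A := by
  rw [eLpNorm_eq_lintegral_rpow_enorm_toReal two_ne_zero ENNReal.ofNat_ne_top,
    ENNReal.toReal_ofNat, one_div, ENNReal.rpow_inv_le_iff two_pos, ENNReal.rpow_ofNat,
    ← ENNReal.ofReal_pow hA]
  simpa only [enorm_eq_self, ENNReal.rpow_ofNat] using h

end MaximalEstimate

theorem proposition3p4 (d : ℕ) (hd : 1 ≤ d) (α : ℝ) (hα0 : 0 < α) (hα1 : α < 1)
    (γ : ℝ) (hγ0 : 0 < γ) (hγd : γ ≤ d) (s : ℝ)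
    (hs : min (max 0 (α * (γ / 2 - (d : ℝ) / 4))) (α / 2) < s) :
    ∃ C : ℝ, 0 < C ∧
      ∀ μ : Measure (Rd d), IsGammaDimensional γ μ →
      ∀ R : ℝ, 1 ≤ R →
      ∀ f : Lp ℂ 2 (volume : Measure (Rd d)), FourierSupportedInAnnulus R f →
        eLpNorm (maximalFunction α f) 2 (μ.restrict (ball 0 1)) ≤
          ENNReal.ofReal (C * R ^ (((d : ℝ) - γ) / 2 + s) *
            Real.sqrt (dimConst γ μ : ℝ) * ‖f‖) := by
  obtain ⟨C, hC, hmaximal⟩ := exists_lintegral_maximalFunction_sq_le_rpow hd hα0 hα1 hγ0.le hs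
  refine ⟨√C, Real.sqrt_pos.2 hC, fun μ hμ R hR f hf => ?_⟩
  refine eLpNorm_two_le_ofReal_of_lintegral_sq_le (by positivity) ?_
  refine (hmaximal μ hμ R hR f hf).trans_eq ?_
  rw [mul_pow, mul_pow, mul_pow, Real.sq_sqrt hC.le, Real.sq_sqrt (dimConst γ μ).coe_nonneg,
    ENNReal.ofReal_mul' (sq_nonneg ‖f‖), ENNReal.ofReal_pow (norm_nonneg f), ofReal_norm]
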